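/- Let $\mathbb D=\{|z|<1\}$, $\mathbb D_e=\{|z|>1\}$, $\mathbb T=\{|z|=1\}$. Let $V$ be a closed isometric operator (with domain $D(V)$ and range $R(V)$, not necessarily dense) in a complex Hilbert space $H$ with identity operator $E$. Put $M_\zeta=(E-\zeta V)D(V)$ for $\zeta\in\mathbb C$, $M_\infty=R(V)$, and $N_\zeta=H\ominus M_\zeta$; here $1/\overline{z_0}=\infty$ when $z_0=0$. Denote by $P_L$ the orthogonal projection of $H$ onto a subspace $L$. A generalized resolvent of $V$ is a function $\mathbf R_z=P_H(E_{\widetilde H}-zU)^{-1}|_H$, $|z|\neq1$, where $U\supseteq V$ is a unitary operator in a Hilbert space $\widetilde H\supseteq H$. A point $\mu$ is of regular type for $V$ if $V-\mu E$ has a bounded inverse on its range. For $z_0\in\mathbb D$ let $V_{z_0}=(V-\overline{z_0}E)(E-z_0V)^{-1}$, an isometric operator from $M_{z_0}$ onto $M_{1/\overline{z_0}}$, and for a bounded operator $C:N_{z_0}\to N_{1/\overline{z_0}}$ let $V^+_{z_0;C}=V_{z_0}\oplus C$ and $V_{C;z_0}=(V^+_{z_0;C}+\overline{z_0}E)(E+z_0V^+_{z_0;C})^{-1}$.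 Let $\mathcal S(N_{z_0};N_{1/\overline{z_0}})$ be the set of analytic functions on $\mathbb D$ whose values are linear contractions from $N_{z_0}$ to $N_{1/\overline{z_0}}$. A function $C(\lambda;z_0)\in\mathcal S(N_{z_0};N_{1/\overline{z_0}})$ corresponds to $\mathbf R_z$ by Inin's formula if $\mathbf R_\lambda=(E-\lambda V_{C(\lambda;z_0);z_0})^{-1}$ for all $\lambda\in\mathbb D$. **Theorem.** Let $V$ be a closed isometric operator in a Hilbert space $H$, and let $\Delta$ be an open arc of $\mathbb T$ such that $\zeta^{-1}$ is a point of regular type of $V$ for every $\zeta\in\Delta$. Let $z_0\in\mathbb D$, put $\Delta_1=\{\frac{\lambda-z_0}{1-\overline{z_0}\lambda}:\lambda\in\Delta\}$, and suppose that $$P_{M_{1/\overline{z_0}}}\,M_{\frac{z_0+\zeta}{1+\zeta\overline{z_0}}}=M_{1/\overline{z_0}}\qquad\text{for all }\zeta\in\Delta_1 .$$ Let $\mathbf R_z$ be a generalized resolvent of $V$, and let $C(\lambda;z_0)\in\mathcal S(N_{z_0};N_{1/\overline{z_0}})$ correspond to it by Inin's formula. Then $\mathbf R_z$ has an analytic continuation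 to $\mathbb D\cup\mathbb D_e\cup\Delta$ if and only if the following three conditions hold: 1. $C(\lambda;z_0)$ has an extension to $\mathbb D\cup\Delta$ that is continuous in the uniform operator topology; 2. for every $\lambda\in\Delta$ the extended $C(\lambda;z_0)$ maps $N_{z_0}$ isometrically onto $N_{1/\overline{z_0}}$; 3. for every $\lambda\in\Delta$ the operator $C(\lambda;z_0)-W_{\lambda;z_0}$ is invertible (injective), and $(C(\lambda;z_0)-W_{\lambda;z_0})N_{z_0}=N_{1/\overline{z_0}}$, where $W_{\lambda;z_0}$ is the operator with domain $P_{N_{z_0}}N_\lambda$ defined by $$W_{\lambda;z_0}P_{N_{z_0}}f=\frac{1-\overline{z_0}\lambda}{\lambda-z_0}\,P_{N_{1/\overline{z_0}}}f,\qquad f\in N_\lambda .$$ -/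

import Mathlib

open Complex ComplexConjugate Set

noncomputable section

namespace IsometricGap

universe u

variable {H : Type u} [NormedAddCommGroup H] [InnerProductSpace ℂ H]

/-- `V`, an operator in `H` with domain `V.domain` (not necessarily dense), is closed and
isometric. -/
structure IsClosedIsometric (V : H →ₗ.[ℂ] H) : Prop where
  isClosed : V.IsClosed
  norm_map : ∀ x : V.domain, ‖V x‖ = ‖(x : H)‖

/-- `μ` is a point of the regular type of `V`: the operator `V - μ E` has a bounded inverse,
defined on the range of `V - μ E`. -/
def IsRegularType (V : H →ₗ.[ℂ] H) (μ : ℂ) : Prop :=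
  ∃ k : ℝ, 0 < k ∧ ∀ x : V.domain, k * ‖(x : H)‖ ≤ ‖V x - μ • (x : H)‖

/-- `M_ζ = (E - ζ V) D(V)` for complex `ζ`, and `M_∞ = R(V)`. -/
def M (V : H →ₗ.[ℂ] H) : OnePoint ℂ → Submodule ℂ H
  | none => LinearMap.range V.toFun
  | some ζ => LinearMap.range (V.domain.subtype - ζ • V.toFun)

/-- `N_ζ = H ⊖ M_ζ`. -/
def N (V : H →ₗ.[ℂ] H) (ζ : OnePoint ℂ) : Submodule ℂ H := (M V ζ)ᗮ

/-- The point `1 / conj z` of the extended complex plane, equal to `∞` for `z = 0`. -/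
def invConj (z : ℂ) : OnePoint ℂ :=
  if z = 0 then OnePoint.infty else ((1 / conj z : ℂ) : OnePoint ℂ)

/-- An open arc of the unit circle (the whole circle is allowed). -/
def IsOpenArc (Δ : Set ℂ) : Prop :=
  ∃ a b : ℝ, a < b ∧ Δ = (fun t : ℝ => exp (t * I)) '' Ioo a b

section aux

variable {V : H →ₗ.[ℂ] H}

lemma mem_M_coe {ζ : ℂ} {y : H} :
    y ∈ M V (ζ : OnePoint ℂ) ↔ ∃ f : V.domain, (f : H) - ζ • V f = y := by
  change y ∈ LinearMap.range (V.domain.subtype - ζ • V.toFun) ↔ _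
  simp [LinearMap.mem_range]

lemma mem_M_invConj {z : ℂ} {y : H} :
    y ∈ M V (invConj z) ↔ ∃ f : V.domain, V f - conj z • (f : H) = y := by
  by_cases hz : z = 0
  · subst hz
    simp only [invConj, if_true, map_zero, zero_smul, sub_zero]
    change y ∈ LinearMap.range V.toFun ↔ _
    simp [LinearMap.mem_range]
  · have hc : conj z ≠ 0 := by simpa using hz
    rw [invConj, if_neg hz, mem_M_coe]
    constructor
    · rintro ⟨f, rfl⟩
      refine ⟨-(conj z)⁻¹ • f, ?_⟩
      rw [LinearPMap.map_smul, Submodule.coe_smul, smul_smul]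
      simp [hc]
      abel
    · rintro ⟨f, rfl⟩
      refine ⟨-conj z • f, ?_⟩
      rw [LinearPMap.map_smul, Submodule.coe_smul, smul_smul]
      simp [hc]
      abel

lemma norm_sub_smul_ge (hV : IsClosedIsometric V) (z : ℂ) (f : V.domain) :
    (1 - ‖z‖) * ‖(f : H)‖ ≤ ‖(f : H) - z • V f‖ := by
  have h := norm_sub_norm_le (f : H) (z • V f)
  rw [norm_smul, hV.norm_map] at h
  linarith

/-- The identity behind the fact that `V_z` is isometric. -/
lemma norm_cayley (hV : IsClosedIsometric V) (z : ℂ) (f : V.domain) :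
    ‖V f - conj z • (f : H)‖ = ‖(f : H) - z • V f‖ := by
  have h : ‖V f - conj z • (f : H)‖ ^ 2 = ‖(f : H) - z • V f‖ ^ 2 := by
    rw [@norm_sub_sq ℂ, @norm_sub_sq ℂ, norm_smul, norm_smul, hV.norm_map f,
      inner_smul_right, inner_smul_right, ← inner_conj_symm (V f) (f : H), ← map_mul,
      RCLike.conj_re, RCLike.norm_conj]
  exact (sq_eq_sq₀ (norm_nonneg _) (norm_nonneg _)).1 h

lemma injective_sub_smul (hV : IsClosedIsometric V) {z : ℂ} (hz : ‖z‖ < 1) :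
    Function.Injective (V.domain.subtype - z • V.toFun) := by
  rw [injective_iff_map_eq_zero]
  intro f hf
  have h := norm_sub_smul_ge hV z f
  have h0 : (f : H) - z • V f = 0 := by simpa using hf
  rw [h0, norm_zero] at h
  have : ‖(f : H)‖ ≤ 0 := by
    by_contra hc
    push Not at hc
    nlinarith
  simpa using this

variable [CompleteSpace H]

lemma isClosed_M (hV : IsClosedIsometric V) {z : ℂ} (hz : ‖z‖ < 1) :
    IsClosed (M V (z : OnePoint ℂ) : Set H) := by
  have hg : IsClosed (V.graph : Set (H × H)) := hV.isClosed
  have : CompleteSpace V.graph := hg.completeSpace_coe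
  let φ : V.graph →L[ℂ] H :=
    ((ContinuousLinearMap.fst ℂ H H) - z • ContinuousLinearMap.snd ℂ H H) ∘L V.graph.subtypeL
  have hφ : AntilipschitzWith (Real.toNNReal (1 - ‖z‖)⁻¹) φ := by
    apply AddMonoidHomClass.antilipschitz_of_bound
    rintro ⟨⟨x, y⟩, hxy⟩
    obtain ⟨f, hf1, hf2⟩ := (LinearPMap.mem_graph_iff V).1 hxy
    simp only at hf1 hf2
    subst hf1 hf2
    have h := norm_sub_smul_ge hV z f
    have h1 : 0 < 1 - ‖z‖ := by linarith
    rw [Real.coe_toNNReal _ (inv_nonneg.2 h1.le), ← div_eq_inv_mul, le_div_iff₀ h1]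
    simpa [φ, Prod.norm_def, hV.norm_map f, mul_comm] using h
  have hr := hφ.isClosed_range φ.uniformContinuous
  convert hr using 1
  ext y
  rw [SetLike.mem_coe, mem_M_coe]
  constructor
  · rintro ⟨f, rfl⟩
    exact ⟨⟨(f, V f), LinearPMap.mem_graph V f⟩, by simp [φ]⟩
  · rintro ⟨⟨⟨x, w⟩, hxw⟩, rfl⟩
    obtain ⟨f, hf1, hf2⟩ := (LinearPMap.mem_graph_iff V).1 hxw
    simp only at hf1 hf2
    subst hf1 hf2
    exact ⟨f, by simp [φ]⟩

end aux

section extension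

variable {V : H →ₗ.[ℂ] H}

/-- The isometric operator `V_z = (V - conj z E) (E - z V)⁻¹`, `|z| < 1`, with the domain `M_z`. -/
def cayley (hV : IsClosedIsometric V) {z : ℂ} (hz : ‖z‖ < 1) :
    M V (z : OnePoint ℂ) →ₗᵢ[ℂ] H where
  toLinearMap := (V.toFun - conj z • V.domain.subtype) ∘ₗ
    ((LinearEquiv.ofInjective _ (injective_sub_smul hV hz)).symm :
      LinearMap.range (V.domain.subtype - z • V.toFun) →ₗ[ℂ] V.domain)
  norm_map' y := by
    obtain ⟨f, rfl⟩ := (LinearEquiv.ofInjective _ (injective_sub_smul hV hz)).surjective y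
    change ‖(V.toFun - conj z • V.domain.subtype)
      ((LinearEquiv.ofInjective _ (injective_sub_smul hV hz)).symm
        ((LinearEquiv.ofInjective _ (injective_sub_smul hV hz)) f))‖ = ‖(f : H) - z • V f‖
    rw [LinearEquiv.symm_apply_apply]
    exact norm_cayley hV z f

variable [CompleteSpace H]

/-- `V⁺_{z;C} = V_z ⊕ C` with respect to `H = M_z ⊕ N_z`, for a bounded operator `C` from `N_z` to
`N_{1 / conj z}`. -/
def plus (hV : IsClosedIsometric V) {z : ℂ} (hz : ‖z‖ < 1)
    (C : N V (z : OnePoint ℂ) →L[ℂ] N V (invConj z)) : H →L[ℂ] H :=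
  have : (M V (z : OnePoint ℂ)).HasOrthogonalProjection :=
    have := (isClosed_M hV hz).completeSpace_coe
    inferInstance
  (cayley hV hz).toContinuousLinearMap ∘L (M V (z : OnePoint ℂ)).orthogonalProjectionOnto +
    (N V (invConj z)).subtypeL ∘L C ∘L
      (M V (z : OnePoint ℂ))ᗮ.orthogonalProjectionOnto

/-- The orthogonal extension `V_{C;z} = (V⁺_{z;C} + conj z E) (E + z V⁺_{z;C})⁻¹` of `V`. -/
def orthogonalExtension (hV : IsClosedIsometric V) {z : ℂ} (hz : ‖z‖ < 1)
    (C : N V (z : OnePoint ℂ) →L[ℂ] N V (invConj z)) : H →L[ℂ] H :=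
  (plus hV hz C + conj z • 1) * Ring.inverse (1 + z • plus hV hz C)

end extension

/-- `R` is a generalized resolvent of `V`: there are a Hilbert space `K`, containing `H` through
the isometric embedding `J`, and a unitary operator `U ⊇ V` in `K`, with
`R z = P^K_H (E_K - z U)⁻¹ |_H` for `|z| ≠ 1`. The adjoint of `J` is the orthogonal projection
of `K` onto `H`. -/
def IsGeneralizedResolvent [CompleteSpace H] (V : H →ₗ.[ℂ] H) (R : ℂ → H →L[ℂ] H) : Prop :=
  ∃ (K : Type u) (_ : NormedAddCommGroup K) (_ : InnerProductSpace ℂ K) (_ : CompleteSpace K)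
    (J : H →ₗᵢ[ℂ] K) (U : unitary (K →L[ℂ] K)),
    (∀ x : V.domain, (U : K →L[ℂ] K) (J x) = J (V x)) ∧
    ∀ z : ℂ, ‖z‖ ≠ 1 →
      R z = J.toContinuousLinearMap.adjoint ∘L
        Ring.inverse (1 - z • (U : K →L[ℂ] K)) ∘L J.toContinuousLinearMap

/-- The class `S(H₁; H₂)` of contraction-valued functions analytic in the open unit disc. -/
structure IsSchur {H₁ H₂ : Submodule ℂ H} (C : ℂ → H₁ →L[ℂ] H₂) : Prop where
  analytic : AnalyticOnNhd ℂ C (Metric.ball 0 1)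
  norm_le_one : ∀ ζ ∈ Metric.ball (0 : ℂ) 1, ‖C ζ‖ ≤ 1

/-- `C(·; z₀)` corresponds to `R` by the formula `R_ζ = (E - ζ V_{C(ζ; z₀); z₀})⁻¹`, `|ζ| < 1`. -/
def CorrespondsTo [CompleteSpace H] {V : H →ₗ.[ℂ] H} (hV : IsClosedIsometric V) {z₀ : ℂ}
    (hz₀ : ‖z₀‖ < 1) (C : ℂ → N V (z₀ : OnePoint ℂ) →L[ℂ] N V (invConj z₀))
    (R : ℂ → H →L[ℂ] H) : Prop :=
  IsSchur C ∧ ∀ ζ ∈ Metric.ball (0 : ℂ) 1,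
    R ζ = Ring.inverse (1 - ζ • orthogonalExtension hV hz₀ (C ζ))

section W

variable [CompleteSpace H]

instance (V : H →ₗ.[ℂ] H) (ζ : OnePoint ℂ) : (N V ζ).HasOrthogonalProjection :=
  inferInstanceAs (M V ζ)ᗮ.HasOrthogonalProjection

/-- The graph of `W_{lam;z₀}`: the pairs
`(P_{N_{z₀}} f, (1 - conj z₀ lam) / (lam - z₀) P_{N_{1 / conj z₀}} f)` with `f ∈ N_lam`. -/
def WGraph (V : H →ₗ.[ℂ] H) (z₀ lam : ℂ) : Submodule ℂ (H × H) :=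
  (N V (lam : OnePoint ℂ)).map
    ((N V (z₀ : OnePoint ℂ)).starProjection.prod
      (((1 - conj z₀ * lam) / (lam - z₀)) • (N V (invConj z₀)).starProjection) :
        H →ₗ[ℂ] H × H)

/-- The operator `W_{lam;z₀}`, with the domain `P_{N_{z₀}} N_lam`. -/
def W (V : H →ₗ.[ℂ] H) (z₀ lam : ℂ) : H →ₗ.[ℂ] H := (WGraph V z₀ lam).toLinearPMap

/-- `W_{lam;z₀}` is well defined for `|lam| = 1`. -/
lemma WGraph_functional {V : H →ₗ.[ℂ] H} (hV : IsClosedIsometric V) {z₀ lam : ℂ}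
    (hz₀ : ‖z₀‖ < 1) (hlam : ‖lam‖ = 1) (p : H × H) (hp : p ∈ WGraph V z₀ lam)
    (h0 : p.1 = 0) : p.2 = 0 := by
  obtain ⟨f, hf, rfl⟩ := hp
  have h0' : (N V (z₀ : OnePoint ℂ)).starProjection f = 0 := h0
  change ((1 - conj z₀ * lam) / (lam - z₀)) • (N V (invConj z₀)).starProjection f = 0
  have hfM : f ∈ M V (z₀ : OnePoint ℂ) := by
    have := (isClosed_M hV hz₀).completeSpace_coe
    have h1 : f ∈ (N V (z₀ : OnePoint ℂ))ᗮ :=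
      (Submodule.starProjection_apply_eq_zero_iff _).1 h0'
    rwa [N, Submodule.orthogonal_orthogonal] at h1
  obtain ⟨g, hg⟩ := mem_M_coe.1 hfM
  set f' := V g - conj z₀ • (g : H) with hf'
  have hn : ‖f'‖ = ‖f‖ := by rw [hf', norm_cayley hV, hg]
  set a : ℂ := 1 - conj z₀ * lam
  set b : ℂ := lam - z₀
  have hll : lam * conj lam = 1 := by rw [mul_conj', hlam]; simp
  have hab : ‖a‖ = ‖b‖ := by
    have : a = lam * conj b := by simp only [a, b, map_sub]; linear_combination -hll
    rw [this, norm_mul, hlam, one_mul, norm_conj]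
  have hb : b ≠ 0 := by
    intro h
    have : lam = z₀ := sub_eq_zero.1 h
    rw [this] at hlam
    linarith
  have hid : a • f - b • f' = (1 - z₀ * conj z₀) • ((g : H) - lam • V g) := by
    rw [← hg, hf']
    simp only [a, b]
    module
  have horth : inner ℂ f (a • f - b • f') = 0 := by
    rw [hid, inner_smul_right, Submodule.inner_left_of_mem_orthogonal
      (mem_M_coe.2 ⟨g, rfl⟩) hf, mul_zero]
  have heq : a • f = b • f' := by
    have h1 : inner ℂ (a • f) (b • f') = ((‖a • f‖ ^ 2 : ℝ) : ℂ) := by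
      rw [inner_sub_right, sub_eq_zero] at horth
      rw [inner_smul_left, ← horth, ← inner_smul_left, inner_self_eq_norm_sq_to_K]
      norm_cast
    have h2 : ‖a • f - b • f'‖ ^ 2 = 0 := by
      rw [@norm_sub_sq ℂ, h1, norm_smul b, norm_smul a, hn, hab]
      simp only [RCLike.re_eq_complex_re, ofReal_re]
      ring
    exact sub_eq_zero.1 (norm_eq_zero.1 (pow_eq_zero_iff (two_ne_zero)|>.1 h2))
  have ha : a ≠ 0 := by
    rw [← norm_ne_zero_iff, hab]
    exact norm_ne_zero_iff.2 hb
  have hfM' : f ∈ M V (invConj z₀) := by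
    have h1 : f = (a⁻¹ * b) • f' := by rw [mul_smul, ← heq, smul_smul, inv_mul_cancel₀ ha, one_smul]
    rw [h1]
    exact Submodule.smul_mem _ _ (mem_M_invConj.2 ⟨g, rfl⟩)
  have : (N V (invConj z₀)).starProjection f = 0 :=
    (Submodule.starProjection_apply_eq_zero_iff _).2 (Submodule.le_orthogonal_orthogonal _ hfM')
  rw [this, smul_zero]

/-- A bounded operator `C` from `N_{z₀}` to `N_{1 / conj z₀}`, regarded as an operator in `H` with
the domain `N_{z₀}`. -/
def toPMap {H₁ H₂ : Submodule ℂ H} (C : H₁ →L[ℂ] H₂) : H →ₗ.[ℂ] H :=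
  ⟨H₁, H₂.subtype ∘ₗ (C : H₁ →ₗ[ℂ] H₂)⟩

/-- The orthogonal projection of `H` onto (the closure of) a subspace. For a closed isometric `V`
and `|z| < 1` it is applied to `M_{1 / conj z}`, which is closed. -/
def proj (L : Submodule ℂ H) : H →L[ℂ] H := L.topologicalClosure.starProjection

end W

end IsometricGap

end

/-!
With `T = V⁺_{z₀;C}`, the resolvent of `V_{C;z₀}` at `λ` is `(1 + z₀ T) P⁻¹`, where the pencil
`P = (1 - conj z₀ λ) - (λ - z₀) T` makes sense also at the points of the arc. If `|λ| = 1` and `P`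
is invertible, then `R = (1 + z₀ T) P⁻¹` satisfies `R + R* = 1` if and only if `T` is unitary, that
is, if and only if `C` is isometric and onto. Moreover `P` is invertible if and only if
`C - W_{λ;z₀}` is bijective: `P` maps `M_{z₀}` onto `M_λ`, and it maps `x` into `N_{1 / conj z₀}`
exactly when `x ∈ N_λ`, in which case `P x = (z₀ - λ) (C - W_{λ;z₀}) P_{N_{z₀}} x`. The condition on
the projection of `M_λ` enters as `M_λ + N_{1 / conj z₀} = H`.

A generalized resolvent satisfies `R(z)* = 1 - R(1 / conj z)`. If `C` extends as required, this
reflection glues the boundary values of `(1 + z₀ T) P⁻¹` to `R` outside the disc, and the result is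
continuous, hence analytic by Painlevé's theorem. Conversely, `P⁻¹` is an affine function of the
resolvent, so it has a limit wherever `R` is continued; since `P` stays bounded, the limit is
invertible, and therefore `T` and `C` have limits too.
-/

noncomputable section

namespace IsometricGap

open Filter Topology

section Painleve

variable {E : Type*} [NormedAddCommGroup E] [NormedSpace ℂ E] {U : Set ℂ} {f : ℂ → E}

lemma wedgeIntegral_add_wedgeIntegral_eq_zero_of_zero_notMem (hc : ContinuousOn f U)
    (hd : ∀ z ∈ U, z.im ≠ 0 → DifferentiableAt ℂ f z) {z w : ℂ}
    (hzw : uIcc z.re w.re ×ℂ uIcc z.im w.im ⊆ U)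
    (h0 : (0 : ℝ) ∉ Ioo (min z.im w.im) (max z.im w.im)) :
    wedgeIntegral z w f + wedgeIntegral w z f = 0 := by
  rw [wedgeIntegral_add_wedgeIntegral_eq]
  refine integral_boundary_rect_eq_zero_of_continuousOn_of_differentiableOn f z w
    (hc.mono hzw) fun s hs => (hd s (hzw ⟨?_, ?_⟩) ?_).differentiableWithinAt
  · exact Ioo_subset_Icc_self hs.1
  · exact Ioo_subset_Icc_self hs.2
  · exact fun h => h0 (h ▸ hs.2)

lemma wedgeIntegral_add_wedgeIntegral_eq_add (hc : ContinuousOn f U) {z w : ℂ}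
    (hzw : uIcc z.re w.re ×ℂ uIcc z.im w.im ⊆ U) {c : ℝ} (hc' : c ∈ uIcc z.im w.im) :
    wedgeIntegral z w f + wedgeIntegral w z f =
      (wedgeIntegral z ⟨w.re, c⟩ f + wedgeIntegral ⟨w.re, c⟩ z f) +
        (wedgeIntegral ⟨z.re, c⟩ w f + wedgeIntegral w ⟨z.re, c⟩ f) := by
  have hint : ∀ x ∈ uIcc z.re w.re, ∀ p q : ℝ, uIcc p q ⊆ uIcc z.im w.im →
      IntervalIntegrable (fun y : ℝ => f (x + y * I)) MeasureTheory.volume p q := by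
    intro x hx p q hpq
    refine ContinuousOn.intervalIntegrable (hc.comp (by fun_prop) fun y hy => hzw ⟨?_, ?_⟩)
    · simpa using hx
    · simpa using hpq hy
  have hl : uIcc z.im c ⊆ uIcc z.im w.im := uIcc_subset_uIcc left_mem_uIcc hc'
  have hr : uIcc c w.im ⊆ uIcc z.im w.im := uIcc_subset_uIcc hc' right_mem_uIcc
  simp only [wedgeIntegral_add_wedgeIntegral_eq]
  rw [← intervalIntegral.integral_add_adjacent_intervals
      (hint _ right_mem_uIcc _ _ hl) (hint _ right_mem_uIcc _ _ hr),
    ← intervalIntegral.integral_add_adjacent_intervals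
      (hint _ left_mem_uIcc _ _ hl) (hint _ left_mem_uIcc _ _ hr), smul_add, smul_add]
  abel

variable [CompleteSpace E]

lemma differentiableOn_of_continuousOn_of_off_real (hU : IsOpen U) (hc : ContinuousOn f U)
    (hd : ∀ z ∈ U, z.im ≠ 0 → DifferentiableAt ℂ f z) : DifferentiableOn ℂ f U := by
  refine (isConservativeOn_and_continuousOn_iff_isDifferentiableOn hU).1 ⟨fun z w hzw => ?_, hc⟩
  rw [← add_eq_zero_iff_eq_neg]
  by_cases h0 : (0 : ℝ) ∈ Ioo (min z.im w.im) (max z.im w.im)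
  · have h0' : (0 : ℝ) ∈ uIcc z.im w.im := Ioo_subset_Icc_self h0
    have hlower := wedgeIntegral_add_wedgeIntegral_eq_zero_of_zero_notMem hc hd
      (w := ⟨w.re, 0⟩) (fun s hs => hzw ⟨hs.1, uIcc_subset_uIcc left_mem_uIcc h0' hs.2⟩)
      (fun h => by rcases le_total z.im 0 with h' | h' <;> simp [h'] at h)
    have hupper := wedgeIntegral_add_wedgeIntegral_eq_zero_of_zero_notMem hc hd
      (z := ⟨z.re, 0⟩) (fun s hs => hzw ⟨hs.1, uIcc_subset_uIcc h0' right_mem_uIcc hs.2⟩)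
      (fun h => by rcases le_total w.im 0 with h' | h' <;> simp [h'] at h)
    rw [wedgeIntegral_add_wedgeIntegral_eq_add hc hzw h0', hlower, hupper, add_zero]
  · exact wedgeIntegral_add_wedgeIntegral_eq_zero_of_zero_notMem hc hd hzw h0

lemma norm_mul_exp_mul_I (lam s : ℂ) : ‖lam * exp (s * I)‖ = ‖lam‖ * Real.exp (-s.im) := by
  rw [norm_mul, norm_exp, mul_I_re]

lemma differentiableOn_of_continuousOn_of_off_unitCircle (hU : IsOpen U) (hc : ContinuousOn f U)
    (hd : ∀ z ∈ U, ‖z‖ ≠ 1 → DifferentiableAt ℂ f z) : DifferentiableOn ℂ f U := by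
  intro lam hlam
  refine DifferentiableAt.differentiableWithinAt ?_
  by_cases h1 : ‖lam‖ = 1
  swap
  · exact hd lam hlam h1
  have hlam0 : lam ≠ 0 := norm_ne_zero_iff.1 (h1 ▸ one_ne_zero)
  set e : ℂ → ℂ := fun s => lam * exp (s * I) with he
  have hV : IsOpen (e ⁻¹' U) := hU.preimage (by fun_prop)
  have h0V : (0 : ℂ) ∈ e ⁻¹' U := by simpa [he] using hlam
  have hg : DifferentiableOn ℂ (f ∘ e) (e ⁻¹' U) := by
    refine differentiableOn_of_continuousOn_of_off_real hV
      (hc.comp (by fun_prop) fun _ hs => hs) fun s hs him => ?_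
    refine (hd _ hs ?_).comp s (by fun_prop)
    rw [he, norm_mul_exp_mul_I, h1]
    simpa using him
  set ψ : ℂ → ℂ := fun z => -I * log (z / lam) with hψ
  have hψlam : ψ lam = 0 := by simp [hψ, hlam0]
  have hψd : DifferentiableAt ℂ ψ lam :=
    ((differentiableAt_id.div_const lam).clog (by simp [hlam0])).const_mul _
  have heψ : ∀ z, z ≠ 0 → e (ψ z) = z := fun z hz => by
    have : -I * log (z / lam) * I = log (z / lam) := by
      linear_combination (-log (z / lam)) * I_mul_I
    simp only [he, hψ]
    rw [this, exp_log (div_ne_zero hz hlam0), mul_div_cancel₀ _ hlam0]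
  have hcomp : DifferentiableAt ℂ ((f ∘ e) ∘ ψ) lam :=
    DifferentiableAt.comp lam (hψlam ▸ hg.differentiableAt (hV.mem_nhds h0V)) hψd
  refine hcomp.congr_of_eventuallyEq ?_
  filter_upwards [eventually_ne_nhds hlam0] with z hz
  simp only [Function.comp_apply, heψ z hz]

end Painleve

section Reflection

lemma conj_inv_eq_self {lam : ℂ} (h : ‖lam‖ = 1) : (conj lam)⁻¹ = lam :=
  inv_eq_of_mul_eq_one_right (by simp [conj_mul', h])

lemma disc_union_exterior : {z : ℂ | ‖z‖ < 1} ∪ {z : ℂ | 1 < ‖z‖} = {z : ℂ | ‖z‖ ≠ 1} := by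
  ext z
  exact lt_or_lt_iff_ne (a := ‖z‖)

lemma isOpen_disc_union_exterior_union {Δ : Set ℂ}
    (hΔ : ∃ U, IsOpen U ∧ U ∩ Metric.sphere 0 1 = Δ) :
    IsOpen ({z : ℂ | ‖z‖ < 1} ∪ {z : ℂ | 1 < ‖z‖} ∪ Δ) := by
  obtain ⟨U, hU, rfl⟩ := hΔ
  have h : {z : ℂ | ‖z‖ < 1} ∪ {z : ℂ | 1 < ‖z‖} ∪ U ∩ Metric.sphere 0 1 =
      {z : ℂ | ‖z‖ ≠ 1} ∪ U := by
    rw [disc_union_exterior]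
    ext z
    by_cases hz : ‖z‖ = 1 <;> simp [hz]
  rw [h]
  exact (isOpen_ne_fun continuous_norm continuous_const).union hU

lemma nhdsWithin_disc_neBot {lam : ℂ} (h : ‖lam‖ = 1) : (𝓝[{z : ℂ | ‖z‖ < 1}] lam).NeBot := by
  rw [← mem_closure_iff_nhdsWithin_neBot, ← ball_zero_eq, closure_ball _ one_ne_zero]
  simp [h]

variable {A : Type*} [NormedRing A] [StarRing A] {R F : ℂ → A} {Δ : Set ℂ}

/-- The Schwarz reflection of `F` in the unit circle that is attached to the antilinear involution
`a ↦ 1 - star a`, which is the symmetry of the resolvents of unitary elements. -/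
def schwarzReflection (F : ℂ → A) (w : ℂ) : A :=
  if ‖w‖ ≤ 1 then F w else 1 - star (F (conj w)⁻¹)

lemma eqOn_schwarzReflection (hstar : ∀ z, z ≠ 0 → ‖z‖ ≠ 1 → star (R z) = 1 - R (conj z)⁻¹)
    (hFR : EqOn F R {z : ℂ | ‖z‖ < 1}) : EqOn (schwarzReflection F) R {z : ℂ | ‖z‖ ≠ 1} := by
  intro w (hw : ‖w‖ ≠ 1)
  rcases hw.lt_or_gt with h | h
  · rw [← hFR h, schwarzReflection, if_pos h.le]
  · have hw0 : w ≠ 0 := norm_pos_iff.1 (zero_lt_one.trans h)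
    have hlt : ‖(conj w)⁻¹‖ < 1 := by simpa using inv_lt_one_of_one_lt₀ h
    have := hstar (conj w)⁻¹ (by simpa using hw0) hlt.ne
    simp only [schwarzReflection, if_neg h.not_ge, hFR hlt, this, map_inv₀, conj_conj, inv_inv,
      sub_sub_cancel]

variable [ContinuousStar A]

lemma add_star_eq_one_of_continuousAt {R' : ℂ → A}
    (hstar : ∀ z, z ≠ 0 → ‖z‖ ≠ 1 → star (R z) = 1 - R (conj z)⁻¹)
    (hRR' : EqOn R' R ({z : ℂ | ‖z‖ < 1} ∪ {z : ℂ | 1 < ‖z‖})) {lam : ℂ} (hlam : ‖lam‖ = 1)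
    (hcont : ContinuousAt R' lam) : R' lam + star (R' lam) = 1 := by
  have := nhdsWithin_disc_neBot hlam
  have hlam0 : lam ≠ 0 := norm_ne_zero_iff.1 (hlam ▸ one_ne_zero)
  have hR' : Tendsto R' (𝓝[{z : ℂ | ‖z‖ < 1}] lam) (𝓝 (R' lam)) := hcont.continuousWithinAt
  have hrefl : Tendsto (fun w => R' (conj w)⁻¹) (𝓝[{z : ℂ | ‖z‖ < 1}] lam) (𝓝 (R' lam)) := by
    have hc : ContinuousAt (fun w : ℂ => (conj w)⁻¹) lam :=
      continuous_conj.continuousAt.inv₀ (by simpa using hlam0)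
    refine (ContinuousAt.comp (f := fun w : ℂ => (conj w)⁻¹) ?_ hc).continuousWithinAt.tendsto.trans
      (by simp [conj_inv_eq_self hlam])
    rwa [conj_inv_eq_self hlam]
  have hsum : ∀ᶠ w in 𝓝[{z : ℂ | ‖z‖ < 1}] lam, R' (conj w)⁻¹ + star (R' w) = 1 := by
    filter_upwards [self_mem_nhdsWithin, nhdsWithin_le_nhds (eventually_ne_nhds hlam0)]
      with w hw hw0
    have hw' : 1 < ‖(conj w)⁻¹‖ := by
      simpa using (one_lt_inv₀ (norm_pos_iff.2 hw0)).2 hw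
    rw [hRR' (Or.inl hw), hRR' (Or.inr hw'), hstar w hw0 (ne_of_lt hw), add_sub_cancel]
  exact tendsto_nhds_unique_of_eventuallyEq (hrefl.add (hR'.star)) tendsto_const_nhds hsum

lemma continuousOn_schwarzReflection (hΔ : Δ ⊆ Metric.sphere 0 1)
    (hF : ContinuousOn F ({z : ℂ | ‖z‖ < 1} ∪ Δ))
    (hFΔ : ∀ lam ∈ Δ, F lam + star (F lam) = 1) :
    ContinuousOn (schwarzReflection F) ({z : ℂ | ‖z‖ < 1} ∪ {z : ℂ | 1 < ‖z‖} ∪ Δ) := by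
  have hΔ1 : ∀ lam ∈ Δ, ‖lam‖ = 1 := fun lam h => mem_sphere_zero_iff_norm.1 (hΔ h)
  refine ContinuousOn.if ?_ (hF.mono ?_) ?_
  · rintro w ⟨hw, hfr⟩
    have h1 : ‖w‖ = 1 := frontier_le_subset_eq continuous_norm continuous_const hfr
    have hwΔ : w ∈ Δ := hw.resolve_left (by simp [h1])
    rw [conj_inv_eq_self h1]
    exact eq_sub_of_add_eq (hFΔ w hwΔ)
  · rintro w ⟨hw, hcl⟩
    have h1 : ‖w‖ ≤ 1 := by rwa [closure_le_eq continuous_norm continuous_const] at hcl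
    exact hw.imp_left fun h => h.resolve_right h1.not_gt
  · have hinv : ∀ w ∈ ({z : ℂ | ‖z‖ < 1} ∪ {z : ℂ | 1 < ‖z‖} ∪ Δ) ∩ closure {w | ¬‖w‖ ≤ 1},
        1 ≤ ‖w‖ ∧ (conj w)⁻¹ ∈ {z : ℂ | ‖z‖ < 1} ∪ Δ := by
      rintro w ⟨hw, hcl⟩
      simp only [not_le] at hcl
      have h1 : 1 ≤ ‖w‖ := closure_lt_subset_le continuous_const continuous_norm hcl
      refine ⟨h1, hw.imp (fun h => ?_) fun h => by rwa [conj_inv_eq_self (hΔ1 w h)]⟩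
      have : 1 < ‖w‖ := h.resolve_left h1.not_gt
      simpa using inv_lt_one_of_one_lt₀ this
    refine continuousOn_const.sub (continuous_star.comp_continuousOn (hF.comp ?_
      fun w hw => (hinv w hw).2))
    refine continuous_conj.continuousOn.inv₀ fun w hw h => ?_
    exact norm_pos_iff.1 (zero_lt_one.trans_le (hinv w hw).1) ((map_eq_zero _).1 h)

lemma exists_analyticOnNhd_of_add_star_eq_one [NormedAlgebra ℂ A] [CompleteSpace A]
    (hΔ : ∃ U, IsOpen U ∧ U ∩ Metric.sphere 0 1 = Δ)
    (hR : ∀ z, ‖z‖ ≠ 1 → AnalyticAt ℂ R z)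
    (hstar : ∀ z, z ≠ 0 → ‖z‖ ≠ 1 → star (R z) = 1 - R (conj z)⁻¹)
    (hF : ContinuousOn F ({z : ℂ | ‖z‖ < 1} ∪ Δ)) (hFR : EqOn F R {z : ℂ | ‖z‖ < 1})
    (hFΔ : ∀ lam ∈ Δ, F lam + star (F lam) = 1) :
    ∃ R' : ℂ → A, AnalyticOnNhd ℂ R' ({z : ℂ | ‖z‖ < 1} ∪ {z : ℂ | 1 < ‖z‖} ∪ Δ) ∧
      EqOn R' R ({z : ℂ | ‖z‖ < 1} ∪ {z : ℂ | 1 < ‖z‖}) := by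
  have hopen := isOpen_disc_union_exterior_union hΔ
  have hΔ1 : Δ ⊆ Metric.sphere 0 1 := by
    obtain ⟨U, -, rfl⟩ := hΔ
    exact inter_subset_right
  have heq := eqOn_schwarzReflection hstar hFR
  refine ⟨schwarzReflection F, (differentiableOn_of_continuousOn_of_off_unitCircle hopen
    (continuousOn_schwarzReflection hΔ1 hF hFΔ) fun w _ hw => ?_).analyticOnNhd hopen,
    disc_union_exterior ▸ heq⟩
  exact (hR w hw).differentiableAt.congr_of_eventuallyEq
    (heq.eventuallyEq_of_mem ((isOpen_ne_fun continuous_norm continuous_const).mem_nhds hw))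

end Reflection

section NormedRing

variable {A ι : Type*} [NormedRing A] [CompleteSpace A] {l : Filter ι} {S : ι → A} {S₀ : A}

lemma isUnit_of_tendsto [l.NeBot] {c : ℝ} (hS : Tendsto S l (𝓝 S₀))
    (hunit : ∀ᶠ i in l, IsUnit (S i)) (hbdd : ∀ᶠ i in l, ‖Ring.inverse (S i)‖ ≤ c) : IsUnit S₀ := by
  have hlim : Tendsto (fun i => c * ‖S i - S₀‖) l (𝓝 0) := by
    simpa using (tendsto_iff_norm_sub_tendsto_zero.1 hS).const_mul c
  obtain ⟨i, hi, hci, hlt⟩ := (hunit.and (hbdd.and (hlim.eventually_lt_const one_pos))).exists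
  have hfactor : S₀ = S i * (1 - Ring.inverse (S i) * (S i - S₀)) := by
    rw [mul_sub, mul_one, Ring.mul_inverse_cancel_left _ _ hi, sub_sub_cancel]
  rw [hfactor]
  refine hi.mul (isUnit_one_sub_of_norm_lt_one ((norm_mul_le _ _).trans_lt ?_))
  exact (mul_le_mul_of_nonneg_right hci (norm_nonneg _)).trans_lt hlt

lemma tendsto_ringInverse (hS : Tendsto S l (𝓝 S₀)) (h : IsUnit S₀) :
    Tendsto (fun i => Ring.inverse (S i)) l (𝓝 (Ring.inverse S₀)) :=
  (h.unit_spec ▸ NormedRing.inverse_continuousAt h.unit : ContinuousAt Ring.inverse S₀).tendsto.comp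
    hS

end NormedRing

section Pencil

lemma norm_sub_sq_add (z lam : ℂ) :
    ‖lam - z‖ ^ 2 + (1 - ‖z‖ ^ 2) * (1 - ‖lam‖ ^ 2) = ‖1 - conj z * lam‖ ^ 2 := by
  simp only [Complex.sq_norm, normSq_apply, sub_re, sub_im, mul_re, mul_im, conj_re, conj_im,
    one_re, one_im]
  ring

lemma one_sub_conj_mul_ne_zero {z lam : ℂ} (hz : ‖z‖ < 1) (hlam : ‖lam‖ ≤ 1) :
    1 - conj z * lam ≠ 0 := by
  intro h
  have h1 : ‖conj z * lam‖ = 1 := by rw [← sub_eq_zero.1 h, norm_one]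
  rw [norm_mul, RCLike.norm_conj] at h1
  nlinarith [norm_nonneg z, norm_nonneg lam]

lemma one_sub_mul_conj_ne_zero {z : ℂ} (hz : ‖z‖ < 1) : 1 - z * conj z ≠ 0 :=
  mul_comm z (conj z) ▸ one_sub_conj_mul_ne_zero hz hz.le

lemma sub_ne_zero_of_norm_eq_one {z lam : ℂ} (hz : ‖z‖ < 1) (hlam : ‖lam‖ = 1) : lam - z ≠ 0 :=
  sub_ne_zero.2 fun h => (h ▸ hlam).not_lt hz

section Ring

variable {A : Type*} [Ring A] [Algebra ℂ A] {z lam : ℂ} {T : A}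

/-- The pencil `(1 - conj z lam) - (lam - z) T`, which is `(1 + z T)` minus `lam (T + conj z)`.
It is the Möbius transform of `1 - lam V` when `T = (V - conj z) (1 - z V)⁻¹`. -/
def pencil (z lam : ℂ) (T : A) : A := (1 - conj z * lam) • 1 - (lam - z) • T

/-- The resolvent `(1 - lam V)⁻¹` of `V = (T + conj z) (1 + z T)⁻¹`, written so that it makes sense
also when `1 + z T` is not invertible. -/
def pencilResolvent (z lam : ℂ) (T : A) : A := (1 + z • T) * Ring.inverse (pencil z lam T)

lemma commute_pencil (z lam : ℂ) (T : A) : Commute (1 + z • T) (pencil z lam T) := by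
  have h : Commute (1 + z • T) T := (Commute.one_left T).add_left ((Commute.refl T).smul_left z)
  exact ((Commute.one_right _).smul_right _).sub_right (h.smul_right _)

lemma inverse_one_sub_smul_mul_inverse (hT : IsUnit (1 + z • T)) (lam : ℂ) :
    Ring.inverse (1 - lam • ((T + conj z • 1) * Ring.inverse (1 + z • T))) =
      pencilResolvent z lam T := by
  have h : 1 - lam • ((T + conj z • 1) * Ring.inverse (1 + z • T)) =
      pencil z lam T * Ring.inverse (1 + z • T) := by
    rw [Ring.eq_mul_inverse_iff_mul_eq _ _ _ hT, sub_mul, one_mul, smul_mul_assoc,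
      Ring.inverse_mul_cancel_right _ _ hT, pencil]
    module
  rw [h, Ring.inverse_mul (Or.inr hT.ringInverse), Ring.inverse_inverse hT, pencilResolvent]

lemma smul_inverse_pencil (h : IsUnit (pencil z lam T)) :
    (lam * (1 - z * conj z)) • Ring.inverse (pencil z lam T) =
      (lam - z) • pencilResolvent z lam T + z • 1 := by
  have h1 : (lam * (1 - z * conj z)) • (1 : A) =
      (lam - z) • (1 + z • T) + z • pencil z lam T := by
    rw [pencil]
    module
  have h2 := congr($h1 * Ring.inverse (pencil z lam T))
  rwa [add_mul, smul_mul_assoc, smul_mul_assoc, smul_mul_assoc, one_mul,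
    Ring.mul_inverse_cancel _ h] at h2

end Ring

section Star

variable {A : Type*} [Ring A] [StarRing A] [Algebra ℂ A] [StarModule ℂ A] {z lam : ℂ} {T : A}

lemma star_one_add_smul (z : ℂ) (T : A) : star (1 + z • T) = 1 + conj z • star T := by
  rw [star_add, star_one, star_smul, starRingEnd_apply]

lemma star_pencil (z lam : ℂ) (T : A) :
    star (pencil z lam T) = pencil (conj z) (conj lam) (star T) := by
  simp only [pencil, star_sub, star_smul, star_one, star_mul', starRingEnd_apply, star_star]

lemma star_pencilResolvent (h : IsUnit (pencil z lam T)) :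
    star (pencilResolvent z lam T) = pencilResolvent (conj z) (conj lam) (star T) := by
  have hstar : IsUnit (pencil (conj z) (conj lam) (star T)) := star_pencil z lam T ▸ h.star
  rw [pencilResolvent, star_mul, ← Ring.inverse_star, star_pencil, star_one_add_smul,
    Ring.inverse_mul_eq_iff_eq_mul _ _ _ hstar, pencilResolvent, ← mul_assoc,
    ← (commute_pencil _ _ _).eq, Ring.mul_inverse_cancel_right _ _ hstar]

lemma star_pencil_mul_add (hlam : ‖lam‖ = 1) :
    star (pencil z lam T) * (1 + z • T) + star (1 + z • T) * pencil z lam T -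
      star (pencil z lam T) * pencil z lam T = (1 - z * conj z) • (1 - star T * T) := by
  have hll : lam * conj lam = 1 := by simp [mul_conj', hlam]
  have h : star (pencil z lam T) * (1 + z • T) + star (1 + z • T) * pencil z lam T -
      star (pencil z lam T) * pencil z lam T = (1 - z * conj z) • (1 - star T * T) +
        (1 - lam * conj lam) • ((z * conj z) • 1 + z • T + conj z • star T + star T * T) := by
    rw [star_pencil, star_one_add_smul]
    simp only [pencil, conj_conj, sub_mul, mul_sub, add_mul, mul_add, one_mul, mul_one,
      smul_mul_assoc, mul_smul_comm]
    module
  rw [h, hll, sub_self, zero_smul, add_zero]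

lemma pencilResolvent_add_star_eq_one_iff (hz : ‖z‖ < 1) (hlam : ‖lam‖ = 1)
    (h : IsUnit (pencil z lam T)) :
    pencilResolvent z lam T + star (pencilResolvent z lam T) = 1 ↔ star T * T = 1 := by
  have hconj : star (pencil z lam T) *
      (pencilResolvent z lam T + star (pencilResolvent z lam T) - 1) * pencil z lam T =
        (1 - z * conj z) • (1 - star T * T) := by
    rw [← star_pencil_mul_add hlam, pencilResolvent, star_mul, ← Ring.inverse_star, mul_sub,
      mul_add, sub_mul, add_mul, mul_one, ← mul_assoc (star _) (1 + z • T),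
      Ring.inverse_mul_cancel_right _ _ h, Ring.mul_inverse_cancel_left _ _ h.star]
  rw [← sub_eq_zero, ← h.star.mul_right_eq_zero, ← h.mul_left_eq_zero, hconj,
    smul_eq_zero_iff_right (one_sub_mul_conj_ne_zero hz), sub_eq_zero, eq_comm]

lemma pencilResolvent_add_star_eq_one_iff_mem_unitary (hz : ‖z‖ < 1) (hlam : ‖lam‖ = 1)
    (h : IsUnit (pencil z lam T)) :
    pencilResolvent z lam T + star (pencilResolvent z lam T) = 1 ↔ T ∈ unitary A := by
  have hstar : IsUnit (pencil (conj z) (conj lam) (star T)) := star_pencil z lam T ▸ h.star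
  have hadj := pencilResolvent_add_star_eq_one_iff (by rwa [norm_conj]) (by rwa [norm_conj]) hstar
  rw [← star_pencilResolvent h, star_star, star_star, add_comm] at hadj
  rw [Unitary.mem_iff, ← pencilResolvent_add_star_eq_one_iff hz hlam h, ← hadj, and_self]

end Star

section Normed

variable {A : Type*} [NormedRing A] [NormedAlgebra ℂ A] {z lam : ℂ} {T : A}

lemma norm_pencil_le (hz : ‖z‖ ≤ 1) (hlam : ‖lam‖ ≤ 1) (hT : ‖T‖ ≤ 1) :
    ‖pencil z lam T‖ ≤ 2 * ‖(1 : A)‖ + 2 := by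
  have ha : ‖1 - conj z * lam‖ ≤ 2 := by
    grw [norm_sub_le, norm_mul, norm_conj, hz, hlam]
    norm_num
  have hb : ‖lam - z‖ ≤ 2 := by
    grw [norm_sub_le, hlam, hz]
    norm_num
  rw [pencil]
  grw [norm_sub_le, norm_smul_le, norm_smul_le, ha, hb, hT, mul_one]

variable [CompleteSpace A]

lemma isUnit_one_sub_smul (hT : ‖T‖ ≤ 1) {c : ℂ} (hc : ‖c‖ < 1) : IsUnit (1 - c • T) := by
  refine isUnit_one_sub_of_norm_lt_one ?_
  rw [norm_smul]
  nlinarith [norm_nonneg c, norm_nonneg T]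

lemma isUnit_one_add_smul (hT : ‖T‖ ≤ 1) (hz : ‖z‖ < 1) : IsUnit (1 + z • T) := by
  simpa only [neg_smul, sub_neg_eq_add] using isUnit_one_sub_smul hT (c := -z) (by rwa [norm_neg])

lemma isUnit_pencil (hz : ‖z‖ < 1) (hlam : ‖lam‖ < 1) (hT : ‖T‖ ≤ 1) :
    IsUnit (pencil z lam T) := by
  have ha := one_sub_conj_mul_ne_zero hz hlam.le
  have h : pencil z lam T =
      (1 - conj z * lam) • (1 - ((lam - z) / (1 - conj z * lam)) • T) := by
    rw [pencil, smul_sub, smul_smul, mul_div_cancel₀ _ ha]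
  rw [h]
  refine (isUnit_smul_iff (Units.mk0 _ ha) _).2 (isUnit_one_sub_smul hT ?_)
  rw [norm_div, div_lt_one (norm_pos_iff.2 ha), ← sq_lt_sq₀ (norm_nonneg _) (norm_nonneg _),
    ← norm_sub_sq_add]
  have h1 : 0 < 1 - ‖z‖ ^ 2 := by nlinarith [norm_nonneg z]
  have h2 : 0 < 1 - ‖lam‖ ^ 2 := by nlinarith [norm_nonneg lam]
  linarith [mul_pos h1 h2]

lemma tendsto_pencilResolvent {l : Filter ℂ} {T : ℂ → A} {T₀ : A} (hl : l ≤ 𝓝 lam)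
    (hT : Tendsto T l (𝓝 T₀)) (h : IsUnit (pencil z lam T₀)) :
    Tendsto (fun w => pencilResolvent z w (T w)) l (𝓝 (pencilResolvent z lam T₀)) := by
  have hid : Tendsto (fun w : ℂ => w) l (𝓝 lam) := hl
  have hpencil : Tendsto (fun w => pencil z w (T w)) l (𝓝 (pencil z lam T₀)) :=
    ((tendsto_const_nhds.sub (hid.const_mul _)).smul_const 1).sub
      ((hid.sub tendsto_const_nhds).smul hT)
  exact (tendsto_const_nhds.add (hT.const_smul z)).mul (tendsto_ringInverse hpencil h)

lemma exists_tendsto_inverse_pencil {l : Filter ℂ} [l.NeBot] {T : ℂ → A} {R₀ : A}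
    (hz : ‖z‖ < 1) (hlam : ‖lam‖ = 1) (hl : l ≤ 𝓝[{w | ‖w‖ < 1}] lam)
    (hT : ∀ w, ‖w‖ < 1 → ‖T w‖ ≤ 1)
    (hR : Tendsto (fun w => pencilResolvent z w (T w)) l (𝓝 R₀)) :
    ∃ S₀, IsUnit S₀ ∧ Tendsto (fun w => Ring.inverse (pencil z w (T w))) l (𝓝 S₀) := by
  have hid : Tendsto (fun w : ℂ => w) l (𝓝 lam) := hl.trans nhdsWithin_le_nhds
  have hdisc : ∀ᶠ w in l, ‖w‖ < 1 := hl self_mem_nhdsWithin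
  have hunit : ∀ᶠ w in l, IsUnit (pencil z w (T w)) :=
    hdisc.mono fun w hw => isUnit_pencil hz hw (hT w hw)
  have hlam0 : lam * (1 - z * conj z) ≠ 0 :=
    mul_ne_zero (norm_ne_zero_iff.1 (hlam ▸ one_ne_zero)) (one_sub_mul_conj_ne_zero hz)
  have hcoeff : Tendsto (fun w : ℂ => w * (1 - z * conj z)) l (𝓝 (lam * (1 - z * conj z))) :=
    hid.mul_const _
  have hS : Tendsto (fun w => Ring.inverse (pencil z w (T w))) l
      (𝓝 ((lam * (1 - z * conj z))⁻¹ • ((lam - z) • R₀ + z • 1))) := by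
    refine ((hcoeff.inv₀ hlam0).smul (((hid.sub_const z).smul hR).add_const _)).congr' ?_
    filter_upwards [hunit, hcoeff.eventually_ne hlam0] with w hw hw0
    rw [← smul_inverse_pencil hw, inv_smul_smul₀ hw0]
  refine ⟨_, isUnit_of_tendsto (c := 2 * ‖(1 : A)‖ + 2) hS
    (hunit.mono fun w hw => hw.ringInverse) ?_, hS⟩
  filter_upwards [hdisc, hunit] with w hw hunit
  rw [Ring.inverse_inverse hunit]
  exact norm_pencil_le hz.le hw.le (hT w hw)

lemma exists_tendsto_of_tendsto_pencilResolvent {l : Filter ℂ} [l.NeBot] {T : ℂ → A} {R₀ : A}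
    (hz : ‖z‖ < 1) (hlam : ‖lam‖ = 1) (hl : l ≤ 𝓝[{w | ‖w‖ < 1}] lam)
    (hT : ∀ w, ‖w‖ < 1 → ‖T w‖ ≤ 1)
    (hR : Tendsto (fun w => pencilResolvent z w (T w)) l (𝓝 R₀)) :
    ∃ T₀, Tendsto T l (𝓝 T₀) ∧ IsUnit (pencil z lam T₀) ∧ pencilResolvent z lam T₀ = R₀ := by
  obtain ⟨S₀, hS₀, hS⟩ := exists_tendsto_inverse_pencil hz hlam hl hT hR
  have hid : Tendsto (fun w : ℂ => w) l (𝓝 lam) := hl.trans nhdsWithin_le_nhds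
  have hlamz := sub_ne_zero_of_norm_eq_one hz hlam
  set T₀ := (lam - z)⁻¹ • ((1 - conj z * lam) • 1 - Ring.inverse S₀) with hT₀
  have hpencil : pencil z lam T₀ = Ring.inverse S₀ := by
    rw [pencil, hT₀, smul_inv_smul₀ hlamz, sub_sub_cancel]
  have hunit : IsUnit (pencil z lam T₀) := hpencil ▸ hS₀.ringInverse
  have htendsto : Tendsto T l (𝓝 T₀) := by
    refine (((hid.sub_const z).inv₀ hlamz).smul (((tendsto_const_nhds.sub
      (hid.const_mul _)).smul_const 1).sub (tendsto_ringInverse hS hS₀))).congr' ?_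
    filter_upwards [hl self_mem_nhdsWithin, (hid.sub_const z).eventually_ne hlamz] with w hw hwz
    rw [Ring.inverse_inverse (isUnit_pencil hz hw (hT w hw)), pencil, sub_sub_cancel,
      inv_smul_smul₀ hwz]
  exact ⟨T₀, htendsto, hunit, tendsto_nhds_unique
    (tendsto_pencilResolvent (hl.trans nhdsWithin_le_nhds) htendsto hunit) hR⟩

end Normed

end Pencil

section UnitaryResolvent

lemma inverse_eq_one_sub_inverse {A : Type*} [Ring A] {X Y : A} (hX : IsUnit X) (hY : IsUnit Y)
    (h : X * Y = X + Y) : Ring.inverse X = 1 - Ring.inverse Y := by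
  have hmul : X * Ring.inverse Y = X - 1 := by
    rw [eq_sub_iff_add_eq, ← Ring.mul_inverse_cancel Y hY, ← add_mul, ← h,
      Ring.mul_inverse_cancel_right _ _ hY]
  rw [← mul_one (Ring.inverse X), Ring.inverse_mul_eq_iff_eq_mul _ _ _ hX, mul_sub, mul_one, hmul,
    sub_sub_cancel]

variable {A : Type*} [NormedRing A] [StarRing A] [CStarRing A] [NormedAlgebra ℂ A]
  [CompleteSpace A]

lemma isUnit_one_sub_smul_unitary (U : unitary A) {z : ℂ} (hz : ‖z‖ ≠ 1) :
    IsUnit (1 - z • (U : A)) := by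
  rcases eq_or_ne z 0 with rfl | hz0
  · simp
  have hmem : z⁻¹ ∉ spectrum ℂ (U : A) := fun h => hz (by
    simpa using Unitary.spectrum_subset_circle U h)
  have hfactor : 1 - z • (U : A) = z • (algebraMap ℂ A z⁻¹ - U) := by
    rw [smul_sub, Algebra.algebraMap_eq_smul_one, smul_inv_smul₀ hz0]
  rw [hfactor]
  exact (isUnit_smul_iff (Units.mk0 z hz0) _).2 (spectrum.notMem_iff.1 hmem)

lemma star_inverse_one_sub_smul_unitary [StarModule ℂ A] (U : unitary A) {z : ℂ} (hz0 : z ≠ 0)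
    (hz : ‖z‖ ≠ 1) :
    star (Ring.inverse (1 - z • (U : A))) = 1 - Ring.inverse (1 - (conj z)⁻¹ • (U : A)) := by
  have hstar : star (1 - z • (U : A)) = 1 - conj z • star (U : A) := by
    rw [star_sub, star_one, star_smul, starRingEnd_apply]
  have hz' : ‖(conj z)⁻¹‖ ≠ 1 := by simpa using hz
  rw [← Ring.inverse_star]
  refine inverse_eq_one_sub_inverse (isUnit_one_sub_smul_unitary U hz).star
    (isUnit_one_sub_smul_unitary U hz') ?_
  rw [hstar, sub_mul, mul_sub, mul_sub, one_mul, mul_one, one_mul, smul_mul_smul_comm,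
    Unitary.coe_star_mul_self, mul_inv_cancel₀ (by simpa using hz0)]
  module

variable {H : Type*} [NormedAddCommGroup H] [InnerProductSpace ℂ H] [CompleteSpace H]
  {V : H →ₗ.[ℂ] H} {R : ℂ → H →L[ℂ] H}

lemma IsGeneralizedResolvent.star_eq (hR : IsGeneralizedResolvent V R) {z : ℂ} (hz0 : z ≠ 0)
    (hz : ‖z‖ ≠ 1) : star (R z) = 1 - R (conj z)⁻¹ := by
  obtain ⟨K, _, _, _, J, U, -, h⟩ := hR
  have hz' : ‖(conj z)⁻¹‖ ≠ 1 := by simpa using hz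
  have hJ : J.toContinuousLinearMap.adjoint ∘L J.toContinuousLinearMap =
      ContinuousLinearMap.id ℂ H :=
    (ContinuousLinearMap.norm_map_iff_adjoint_comp_self _).1 J.norm_map
  have hs := star_inverse_one_sub_smul_unitary U hz0 hz
  rw [ContinuousLinearMap.star_eq_adjoint] at hs ⊢
  rw [h z hz, h _ hz', ContinuousLinearMap.adjoint_comp, ContinuousLinearMap.adjoint_comp,
    ContinuousLinearMap.adjoint_adjoint, hs, ContinuousLinearMap.comp_assoc,
    ContinuousLinearMap.sub_comp, ContinuousLinearMap.comp_sub, ContinuousLinearMap.one_def,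
    ContinuousLinearMap.id_comp, hJ, ContinuousLinearMap.one_def]

lemma IsGeneralizedResolvent.analyticAt (hR : IsGeneralizedResolvent V R) {z : ℂ}
    (hz : ‖z‖ ≠ 1) : AnalyticAt ℂ R z := by
  obtain ⟨K, _, _, _, J, U, -, h⟩ := hR
  have hopen : IsOpen {z : ℂ | ‖z‖ ≠ 1} := isOpen_ne_fun continuous_norm continuous_const
  have hresolvent : ∀ w : ℂ, ‖w‖ ≠ 1 →
      DifferentiableAt ℂ (fun w : ℂ => Ring.inverse (1 - w • (U : K →L[ℂ] K))) w := fun w hw =>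
    DifferentiableAt.inverse (by fun_prop) (isUnit_one_sub_smul_unitary U hw)
  have hd : DifferentiableOn ℂ R {z : ℂ | ‖z‖ ≠ 1} :=
    DifferentiableOn.congr (fun w hw => ((differentiableAt_const _).clm_comp
      ((hresolvent w hw).clm_comp (differentiableAt_const _))).differentiableWithinAt) h
  exact hd.analyticAt (hopen.mem_nhds hz)

end UnitaryResolvent

section Extension

variable {H : Type*} [NormedAddCommGroup H] [InnerProductSpace ℂ H]
  {V : H →ₗ.[ℂ] H} (hV : IsClosedIsometric V) {z : ℂ} (hz : ‖z‖ < 1)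

lemma cayley_apply (f : V.domain) :
    cayley hV hz ⟨(f : H) - z • V f, mem_M_coe.2 ⟨f, rfl⟩⟩ = V f - conj z • (f : H) :=
  congrArg (V.toFun - conj z • V.domain.subtype)
    (LinearEquiv.symm_apply_apply (LinearEquiv.ofInjective _ (injective_sub_smul hV hz)) f)

lemma range_cayley : LinearMap.range (cayley hV hz).toLinearMap = M V (invConj z) := by
  ext y
  rw [mem_M_invConj]
  constructor
  · rintro ⟨⟨x, hx⟩, rfl⟩
    obtain ⟨f, rfl⟩ := mem_M_coe.1 hx
    exact ⟨f, (cayley_apply hV hz f).symm⟩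
  · rintro ⟨f, rfl⟩
    exact ⟨_, cayley_apply hV hz f⟩

lemma norm_add_sq_of_mem_orthogonal {K : Submodule ℂ H} {F n : H} (hF : F ∈ K) (hn : n ∈ Kᗮ) :
    ‖F + n‖ ^ 2 = ‖F‖ ^ 2 + ‖n‖ ^ 2 := by
  simpa only [sq] using norm_add_sq_eq_norm_sq_add_norm_sq_of_inner_eq_zero _ _
    (Submodule.inner_right_of_mem_orthogonal hF hn)

variable [CompleteSpace H]

lemma isClosed_M_invConj (hV : IsClosedIsometric V) (hz : ‖z‖ < 1) :
    IsClosed (M V (invConj z) : Set H) := by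
  have := (isClosed_M hV hz).completeSpace_coe
  rw [← range_cayley hV hz]
  exact (cayley hV hz).isometry.isClosedEmbedding.isClosed_range

lemma exists_eq_add_of_isClosed {K : Submodule ℂ H} (hK : IsClosed (K : Set H)) (x : H) :
    ∃ F ∈ K, ∃ n ∈ Kᗮ, x = F + n := by
  have := hK.completeSpace_coe
  exact K.exists_add_mem_mem_orthogonal x

lemma starProjection_N_eq_zero_iff {ζ : OnePoint ℂ} (hM : IsClosed (M V ζ : Set H)) {x : H} :
    (N V ζ).starProjection x = 0 ↔ x ∈ M V ζ := by
  have := hM.completeSpace_coe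
  rw [Submodule.starProjection_apply_eq_zero_iff, N, Submodule.orthogonal_orthogonal]

variable (C : N V (z : OnePoint ℂ) →L[ℂ] N V (invConj z))

lemma plus_apply (x : H) :
    haveI := (isClosed_M hV hz).completeSpace_coe
    plus hV hz C x = cayley hV hz ((M V (z : OnePoint ℂ)).orthogonalProjectionOnto x) +
      C ((N V (z : OnePoint ℂ)).orthogonalProjectionOnto x) :=
  rfl

lemma plus_apply_M (x : M V (z : OnePoint ℂ)) : plus hV hz C x = cayley hV hz x := by
  have := (isClosed_M hV hz).completeSpace_coe
  have hx : (N V (z : OnePoint ℂ)).orthogonalProjectionOnto (x : H) = 0 :=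
    Submodule.orthogonalProjectionOnto_orthogonal_apply_eq_zero x.2
  rw [plus_apply, Submodule.orthogonalProjectionOnto_mem_subspace_eq_self, hx, map_zero,
    Submodule.coe_zero, add_zero]

lemma plus_apply_N (n : N V (z : OnePoint ℂ)) : plus hV hz C n = C n := by
  have := (isClosed_M hV hz).completeSpace_coe
  rw [plus_apply, Submodule.orthogonalProjectionOnto_eq_zero_iff.2 n.2,
    Submodule.orthogonalProjectionOnto_mem_subspace_eq_self, map_zero, zero_add]

lemma plus_apply_sub (f : V.domain) :
    plus hV hz C ((f : H) - z • V f) = V f - conj z • (f : H) :=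
  (plus_apply_M hV hz C ⟨_, mem_M_coe.2 ⟨f, rfl⟩⟩).trans (cayley_apply hV hz f)

lemma map_plus_M : (M V (z : OnePoint ℂ)).map (plus hV hz C : H →ₗ[ℂ] H) = M V (invConj z) := by
  ext y
  simp only [Submodule.mem_map, mem_M_coe, mem_M_invConj, ContinuousLinearMap.coe_coe,
    exists_exists_eq_and, plus_apply_sub]

lemma plus_mem_M {F : H} (hF : F ∈ M V (z : OnePoint ℂ)) : plus hV hz C F ∈ M V (invConj z) :=
  map_plus_M hV hz C ▸ Submodule.mem_map_of_mem hF

lemma plus_mem_N {n : H} (hn : n ∈ N V (z : OnePoint ℂ)) : plus hV hz C n ∈ N V (invConj z) :=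
  plus_apply_N hV hz C ⟨n, hn⟩ ▸ (C _).2

lemma inner_plus_plus {G : H} (hG : G ∈ M V (z : OnePoint ℂ)) (x : H) :
    inner ℂ (plus hV hz C G) (plus hV hz C x) = inner ℂ G x := by
  obtain ⟨F, hF, n, hn, rfl⟩ := exists_eq_add_of_isClosed (isClosed_M hV hz) x
  rw [map_add, inner_add_right, inner_add_right, Submodule.inner_right_of_mem_orthogonal hG hn,
    Submodule.inner_right_of_mem_orthogonal (plus_mem_M hV hz C hG) (plus_mem_N hV hz C hn),
    plus_apply_M hV hz C ⟨F, hF⟩, plus_apply_M hV hz C ⟨G, hG⟩, (cayley hV hz).inner_map_map]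
  rfl

lemma norm_plus_add_sq {F n : H} (hF : F ∈ M V (z : OnePoint ℂ)) (hn : n ∈ N V (z : OnePoint ℂ)) :
    ‖plus hV hz C (F + n)‖ ^ 2 = ‖F‖ ^ 2 + ‖C ⟨n, hn⟩‖ ^ 2 := by
  rw [map_add, norm_add_sq_of_mem_orthogonal (plus_mem_M hV hz C hF) (plus_mem_N hV hz C hn),
    plus_apply_M hV hz C ⟨F, hF⟩, plus_apply_N hV hz C ⟨n, hn⟩, (cayley hV hz).norm_map]
  rfl

lemma norm_plus_le_one {C : N V (z : OnePoint ℂ) →L[ℂ] N V (invConj z)} (hC : ‖C‖ ≤ 1) :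
    ‖plus hV hz C‖ ≤ 1 := by
  refine ContinuousLinearMap.opNorm_le_bound _ zero_le_one fun x => ?_
  obtain ⟨F, hF, n, hn, rfl⟩ := exists_eq_add_of_isClosed (isClosed_M hV hz) x
  rw [one_mul, ← sq_le_sq₀ (norm_nonneg _) (norm_nonneg _), norm_plus_add_sq hV hz C hF hn,
    norm_add_sq_of_mem_orthogonal hF hn]
  have h : ‖C ⟨n, hn⟩‖ ≤ ‖n‖ := C.le_of_opNorm_le hC ⟨n, hn⟩ |>.trans_eq (one_mul _)
  gcongr

lemma continuous_plus : Continuous (plus hV hz) := by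
  unfold plus
  fun_prop

lemma orthogonalProjectionOnto_plus (x : H) :
    (N V (invConj z)).orthogonalProjectionOnto (plus hV hz C x) =
      C ((N V (z : OnePoint ℂ)).orthogonalProjectionOnto x) := by
  have := (isClosed_M hV hz).completeSpace_coe
  have hcayley : (N V (invConj z)).orthogonalProjectionOnto
      (cayley hV hz ((M V (z : OnePoint ℂ)).orthogonalProjectionOnto x)) = 0 :=
    Submodule.orthogonalProjectionOnto_orthogonal_apply_eq_zero
      (range_cayley hV hz ▸ LinearMap.mem_range_self _ _)
  rw [plus_apply, map_add, hcayley, zero_add]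
  exact Submodule.orthogonalProjectionOnto_mem_subspace_eq_self _

lemma compression_plus :
    (N V (invConj z)).orthogonalProjectionOnto ∘L plus hV hz C ∘L (N V (z : OnePoint ℂ)).subtypeL
      = C := by
  ext1 n
  simp only [ContinuousLinearMap.comp_apply, Submodule.subtypeL_apply,
    orthogonalProjectionOnto_plus, Submodule.orthogonalProjectionOnto_mem_subspace_eq_self]

lemma surjective_plus_iff : Function.Surjective (plus hV hz C) ↔ Function.Surjective C := by
  constructor
  · intro h y
    obtain ⟨x, hx⟩ := h y
    refine ⟨(N V (z : OnePoint ℂ)).orthogonalProjectionOnto x, ?_⟩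
    rw [← orthogonalProjectionOnto_plus hV hz, hx,
      Submodule.orthogonalProjectionOnto_mem_subspace_eq_self]
  · intro h y
    obtain ⟨G, hG, n, hn, rfl⟩ := exists_eq_add_of_isClosed (isClosed_M_invConj hV hz) y
    rw [← map_plus_M hV hz C] at hG
    obtain ⟨F, -, rfl⟩ := hG
    obtain ⟨m, hm⟩ := h ⟨n, hn⟩
    exact ⟨F + m, by rw [map_add, plus_apply_N, hm, ContinuousLinearMap.coe_coe]⟩

lemma mem_unitary_iff_norm_map_and_surjective {T : H →L[ℂ] H} :
    T ∈ unitary (H →L[ℂ] H) ↔ (∀ x, ‖T x‖ = ‖x‖) ∧ Function.Surjective T := by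
  refine ⟨fun h => ⟨T.norm_map_of_mem_unitary h, fun y => ⟨star T y, ?_⟩⟩, fun ⟨hnorm, hsurj⟩ => ?_⟩
  · exact congr($(Unitary.mul_star_self_of_mem h) y)
  · refine IsUnit.mem_unitary_of_star_mul_self (ContinuousLinearMap.isUnit_iff_bijective.2
      ⟨(AddMonoidHomClass.isometry_of_norm T hnorm).injective, hsurj⟩) ?_
    exact T.norm_map_iff_adjoint_comp_self.1 hnorm

lemma plus_mem_unitary_iff :
    plus hV hz C ∈ unitary (H →L[ℂ] H) ↔ Isometry C ∧ Function.Surjective C := by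
  rw [mem_unitary_iff_norm_map_and_surjective, surjective_plus_iff,
    AddMonoidHomClass.isometry_iff_norm]
  refine and_congr_left fun _ => ⟨fun h n => ?_, fun h x => ?_⟩
  · rw [Submodule.coe_norm, ← plus_apply_N hV hz, h, Submodule.coe_norm]
  · obtain ⟨F, hF, n, hn, rfl⟩ := exists_eq_add_of_isClosed (isClosed_M hV hz) x
    rw [← sq_eq_sq₀ (norm_nonneg _) (norm_nonneg _), norm_plus_add_sq hV hz C hF hn,
      norm_add_sq_of_mem_orthogonal hF hn, h, Submodule.coe_norm]

end Extension

section BoundaryCriterion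

variable {H : Type*} [NormedAddCommGroup H] [InnerProductSpace ℂ H]

lemma pencil_apply (z lam : ℂ) (T : H →L[ℂ] H) (x : H) :
    pencil z lam T x = (1 - conj z * lam) • x - (lam - z) • T x :=
  rfl

variable [CompleteSpace H] {V : H →ₗ.[ℂ] H} (hV : IsClosedIsometric V) {z lam : ℂ} (hz : ‖z‖ < 1)
  (C : N V (z : OnePoint ℂ) →L[ℂ] N V (invConj z))

lemma pencil_plus_sub (f : V.domain) :
    pencil z lam (plus hV hz C) ((f : H) - z • V f) =
      (1 - z * conj z) • ((f : H) - lam • V f) := by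
  rw [pencil_apply, plus_apply_sub]
  module

lemma map_pencil_plus_M : (M V (z : OnePoint ℂ)).map
    (pencil z lam (plus hV hz C)).toLinearMap = M V (lam : OnePoint ℂ) := by
  ext y
  simp only [Submodule.mem_map, mem_M_coe, ContinuousLinearMap.coe_coe, exists_exists_eq_and,
    pencil_plus_sub]
  have hc := one_sub_mul_conj_ne_zero hz
  refine ⟨fun ⟨f, hf⟩ => ⟨(1 - z * conj z) • f, ?_⟩, fun ⟨f, hf⟩ => ⟨(1 - z * conj z)⁻¹ • f, ?_⟩⟩
  · rw [← hf, LinearPMap.map_smul, Submodule.coe_smul, smul_sub, smul_comm lam]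
  · rw [← hf, LinearPMap.map_smul, Submodule.coe_smul, smul_comm lam, ← smul_sub,
      smul_inv_smul₀ hc]

lemma inner_plus_pencil_plus (hlam : ‖lam‖ = 1) {G : H} (hG : G ∈ M V (z : OnePoint ℂ)) (x : H) :
    inner ℂ (plus hV hz C G) (pencil z lam (plus hV hz C) x) =
      -lam * inner ℂ (pencil z lam (plus hV hz C) G) x := by
  have hll : lam * conj lam = 1 := by simp [mul_conj', hlam]
  simp only [pencil_apply, inner_sub_right, inner_sub_left, inner_smul_right, inner_smul_left,
    inner_plus_plus hV hz C hG, map_sub, map_one, map_mul, conj_conj]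
  linear_combination (-(z * inner ℂ G x) - inner ℂ (plus hV hz C G) x) * hll

lemma pencil_plus_mem_N_iff (hlam : ‖lam‖ = 1) {x : H} :
    pencil z lam (plus hV hz C) x ∈ N V (invConj z) ↔ x ∈ N V (lam : OnePoint ℂ) := by
  have hlam0 : -lam ≠ 0 := neg_ne_zero.2 (norm_ne_zero_iff.1 (hlam ▸ one_ne_zero))
  rw [N, N, ← map_plus_M hV hz C, ← map_pencil_plus_M hV hz C (lam := lam)]
  simp only [Submodule.mem_orthogonal, Submodule.mem_map, ContinuousLinearMap.coe_coe,
    forall_exists_index, and_imp, forall_apply_eq_imp_iff₂]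
  refine forall₂_congr fun G hG => ?_
  rw [inner_plus_pencil_plus hV hz C hlam hG, mul_eq_zero_iff_left hlam0]

lemma pencil_plus_of_mem_N (hlam : ‖lam‖ = 1) {x : H} (hx : x ∈ N V (lam : OnePoint ℂ)) :
    pencil z lam (plus hV hz C) x = (1 - conj z * lam) • (N V (invConj z)).starProjection x -
      (lam - z) • (C ((N V (z : OnePoint ℂ)).orthogonalProjectionOnto x) : H) := by
  rw [← Submodule.starProjection_eq_self_iff.2 ((pencil_plus_mem_N_iff hV hz C hlam).2 hx),
    pencil_apply, map_sub, map_smul, map_smul, ← orthogonalProjectionOnto_plus hV hz]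
  rfl

lemma mem_graph_sub_iff {R E F : Type*} [Ring R] [AddCommGroup E] [Module R E] [AddCommGroup F]
    [Module R F] {f g : E →ₗ.[R] F} {u : E} {v : F} :
    (u, v) ∈ (f - g).graph ↔ ∃ a b, (u, a) ∈ f.graph ∧ (u, b) ∈ g.graph ∧ a - b = v := by
  simp only [LinearPMap.mem_graph_iff]
  constructor
  · rintro ⟨x, rfl, rfl⟩
    exact ⟨_, _, ⟨⟨x, x.2.1⟩, rfl, rfl⟩, ⟨⟨x, x.2.2⟩, rfl, rfl⟩, rfl⟩
  · rintro ⟨_, _, ⟨⟨_, hf⟩, rfl, rfl⟩, ⟨⟨_, hg⟩, rfl, rfl⟩, rfl⟩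
    exact ⟨⟨_, hf, hg⟩, rfl, rfl⟩

lemma graph_W (hV : IsClosedIsometric V) (hz : ‖z‖ < 1) (hlam : ‖lam‖ = 1) :
    (W V z lam).graph = WGraph V z lam :=
  Submodule.toLinearPMap_graph_eq _ (WGraph_functional hV hz hlam)

lemma injective_iff_mem_graph_zero {R E F : Type*} [Ring R] [AddCommGroup E] [Module R E]
    [AddCommGroup F] [Module R F] {f : E →ₗ.[R] F} :
    Function.Injective f.toFun ↔ ∀ u, (u, 0) ∈ f.graph → u = 0 := by
  rw [injective_iff_map_eq_zero]
  refine ⟨fun h u hu => ?_, fun h x hx => Subtype.ext (h x ((LinearPMap.mem_graph_iff f).2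
    ⟨x, rfl, hx⟩))⟩
  obtain ⟨x, rfl, hx⟩ := (LinearPMap.mem_graph_iff f).1 hu
  exact congrArg Subtype.val (h x hx)

lemma mem_graph_toPMap_sub_W_iff (hlam : ‖lam‖ = 1) {u v : H} :
    (u, v) ∈ (toPMap C - W V z lam).graph ↔ ∃ x ∈ N V (lam : OnePoint ℂ),
      (N V (z : OnePoint ℂ)).starProjection x = u ∧
        pencil z lam (plus hV hz C) x = (z - lam) • v := by
  have hb := sub_ne_zero_of_norm_eq_one hz hlam
  have hpencil {x : H} (hx : x ∈ N V (lam : OnePoint ℂ)) :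
      pencil z lam (plus hV hz C) x =
        (z - lam) • ((C ((N V (z : OnePoint ℂ)).orthogonalProjectionOnto x) : H) -
          ((1 - conj z * lam) / (lam - z)) • (N V (invConj z)).starProjection x) := by
    rw [pencil_plus_of_mem_N hV hz C hlam hx, div_eq_inv_mul, mul_smul, smul_sub, ← neg_sub lam z,
      neg_smul, neg_smul, smul_inv_smul₀ hb]
    abel
  have hW {b : H} : (u, b) ∈ (W V z lam).graph ↔ ∃ x ∈ N V (lam : OnePoint ℂ),
      (N V (z : OnePoint ℂ)).starProjection x = u ∧
        ((1 - conj z * lam) / (lam - z)) • (N V (invConj z)).starProjection x = b := by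
    rw [graph_W hV hz hlam]
    exact exists_congr fun x => and_congr_right fun _ => Prod.ext_iff
  rw [mem_graph_sub_iff]
  constructor
  · rintro ⟨a, b, hC, hb', rfl⟩
    obtain ⟨x, hx, rfl, rfl⟩ := hW.1 hb'
    obtain ⟨n, hn, rfl⟩ := (LinearPMap.mem_graph_iff _).1 hC
    exact ⟨x, hx, rfl, Subtype.ext hn ▸ hpencil hx⟩
  · rintro ⟨x, hx, rfl, hv⟩
    refine ⟨_, _, LinearPMap.mem_graph (toPMap C) _, hW.2 ⟨x, hx, rfl, rfl⟩, ?_⟩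
    exact smul_right_injective H (sub_ne_zero.2 (sub_ne_zero.1 hb).symm)
      ((hpencil hx).symm.trans hv)

lemma range_toPMap_sub_W (hlam : ‖lam‖ = 1) :
    LinearMap.range (toPMap C - W V z lam).toFun =
      N V (invConj z) ⊓ LinearMap.range (pencil z lam (plus hV hz C)).toLinearMap := by
  have hb : z - lam ≠ 0 := sub_ne_zero.2 (sub_ne_zero.1 (sub_ne_zero_of_norm_eq_one hz hlam)).symm
  ext v
  have hmem : v ∈ LinearMap.range (toPMap C - W V z lam).toFun ↔
      ∃ u, (u, v) ∈ (toPMap C - W V z lam).graph := LinearPMap.mem_range_iff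
  simp only [hmem, mem_graph_toPMap_sub_W_iff hV hz C hlam, ← pencil_plus_mem_N_iff hV hz C hlam,
    Submodule.mem_inf, LinearMap.mem_range, ContinuousLinearMap.coe_coe]
  constructor
  · rintro ⟨_, x, hx, rfl, hv⟩
    rw [hv, Submodule.smul_mem_iff _ hb] at hx
    exact ⟨hx, (z - lam)⁻¹ • x, by rw [map_smul, hv, inv_smul_smul₀ hb]⟩
  · rintro ⟨hv, x, rfl⟩
    have hx : pencil z lam (plus hV hz C) ((z - lam) • x) =
        (z - lam) • pencil z lam (plus hV hz C) x := map_smul _ _ _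
    exact ⟨_, (z - lam) • x, hx ▸ Submodule.smul_mem _ _ hv, rfl, hx⟩

lemma sup_orthogonal_eq_top_of_map_proj_eq {K L : Submodule ℂ H} (hL : IsClosed (L : Set H))
    (h : K.map (proj L : H →ₗ[ℂ] H) = L) : K ⊔ Lᗮ = ⊤ := by
  refine Submodule.eq_top_iff'.2 fun x => ?_
  obtain ⟨y, hy, n, hn, rfl⟩ := exists_eq_add_of_isClosed hL x
  rw [← h] at hy
  obtain ⟨k, hk, rfl⟩ := hy
  have hk' : k - proj L k ∈ Lᗮ :=
    L.orthogonal_closure ▸ Submodule.sub_starProjection_mem_orthogonal k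
  refine Submodule.mem_sup.2 ⟨k, hk, n - (k - proj L k), Submodule.sub_mem _ hn hk', ?_⟩
  rw [ContinuousLinearMap.coe_coe]
  abel

lemma surjective_pencil_plus_iff (hlam : ‖lam‖ = 1)
    (hrange : M V (lam : OnePoint ℂ) ⊔ N V (invConj z) = ⊤) :
    Function.Surjective ⇑(pencil z lam (plus hV hz C)) ↔
      LinearMap.range (toPMap C - W V z lam).toFun = N V (invConj z) := by
  rw [range_toPMap_sub_W hV hz C hlam, inf_eq_left, ← ContinuousLinearMap.coe_coe,
    ← LinearMap.range_eq_top]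
  refine ⟨fun h => h ▸ le_top, fun h => eq_top_iff.2 (hrange ▸ sup_le ?_ h)⟩
  exact map_pencil_plus_M hV hz C ▸ LinearMap.map_le_range

lemma eq_zero_of_mem_M_of_pencil_plus_eq_zero (hlam : ‖lam‖ = 1)
    (hrange : M V (lam : OnePoint ℂ) ⊔ N V (invConj z) = ⊤) {F : H}
    (hF : F ∈ M V (z : OnePoint ℂ)) (h : pencil z lam (plus hV hz C) F = 0) : F = 0 := by
  have ha : 1 - conj z * lam ≠ 0 := one_sub_conj_mul_ne_zero hz hlam.le
  have hFlam : F ∈ N V (lam : OnePoint ℂ) :=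
    (pencil_plus_mem_N_iff hV hz C hlam).1 (h ▸ Submodule.zero_mem _)
  have hFM : F ∈ M V (invConj z) := by
    have heq : (1 - conj z * lam) • F = (lam - z) • plus hV hz C F := sub_eq_zero.1 h
    rw [← Submodule.smul_mem_iff _ ha, heq]
    exact Submodule.smul_mem _ _ (plus_mem_M hV hz C hF)
  have hle : M V (lam : OnePoint ℂ) ⊔ N V (invConj z) ≤ (ℂ ∙ F)ᗮ :=
    sup_le (fun G hG => Submodule.mem_orthogonal_singleton_iff_inner_right.2
      (Submodule.inner_left_of_mem_orthogonal hG hFlam))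
      fun n hn => Submodule.mem_orthogonal_singleton_iff_inner_right.2
        (Submodule.inner_right_of_mem_orthogonal hFM hn)
  rw [hrange, top_le_iff, Submodule.orthogonal_eq_top_iff, Submodule.span_singleton_eq_bot] at hle
  exact hle

lemma injective_pencil_plus_iff (hlam : ‖lam‖ = 1)
    (hrange : M V (lam : OnePoint ℂ) ⊔ N V (invConj z) = ⊤) :
    Function.Injective ⇑(pencil z lam (plus hV hz C)) ↔
      Function.Injective (toPMap C - W V z lam).toFun := by
  have hinj : Function.Injective (toPMap C - W V z lam).toFun ↔
      ∀ u, (u, 0) ∈ (toPMap C - W V z lam).graph → u = 0 := injective_iff_mem_graph_zero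
  simp only [hinj, injective_iff_map_eq_zero, mem_graph_toPMap_sub_W_iff hV hz C hlam, smul_zero]
  constructor
  · rintro h _ ⟨x, -, rfl, hx⟩
    rw [h x hx, map_zero]
  · intro h x hx
    have hxN : x ∈ N V (lam : OnePoint ℂ) :=
      (pencil_plus_mem_N_iff hV hz C hlam).1 (hx ▸ Submodule.zero_mem _)
    have hxM := (starProjection_N_eq_zero_iff (isClosed_M hV hz)).1 (h _ ⟨x, hxN, rfl, hx⟩)
    exact eq_zero_of_mem_M_of_pencil_plus_eq_zero hV hz C hlam hrange hxM hx

lemma isUnit_pencil_plus_iff (hlam : ‖lam‖ = 1)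
    (hrange : (M V (lam : OnePoint ℂ)).map (proj (M V (invConj z)) : H →ₗ[ℂ] H) =
      M V (invConj z)) :
    IsUnit (pencil z lam (plus hV hz C)) ↔
      Function.Injective (toPMap C - W V z lam).toFun ∧
        LinearMap.range (toPMap C - W V z lam).toFun = N V (invConj z) := by
  have hsup := sup_orthogonal_eq_top_of_map_proj_eq (isClosed_M_invConj hV hz) hrange
  rw [ContinuousLinearMap.isUnit_iff_bijective, Function.Bijective,
    injective_pencil_plus_iff hV hz C hlam hsup, surjective_pencil_plus_iff hV hz C hlam hsup]

end BoundaryCriterion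

section Continuation

variable {H : Type*} [NormedAddCommGroup H] [InnerProductSpace ℂ H] [CompleteSpace H]
  {V : H →ₗ.[ℂ] H} {hV : IsClosedIsometric V} {z₀ : ℂ} {hz₀ : ‖z₀‖ < 1} {R : ℂ → H →L[ℂ] H}
  {C : ℂ → N V (z₀ : OnePoint ℂ) →L[ℂ] N V (invConj z₀)} {Δ : Set ℂ}

lemma CorrespondsTo.norm_plus_le_one (hC : CorrespondsTo hV hz₀ C R) {w : ℂ} (hw : ‖w‖ < 1) :
    ‖plus hV hz₀ (C w)‖ ≤ 1 :=
  IsometricGap.norm_plus_le_one hV hz₀ (hC.1.norm_le_one w (mem_ball_zero_iff.2 hw))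

lemma CorrespondsTo.eq_pencilResolvent (hC : CorrespondsTo hV hz₀ C R) {w : ℂ} (hw : ‖w‖ < 1) :
    R w = pencilResolvent z₀ w (plus hV hz₀ (C w)) :=
  (hC.2 w (mem_ball_zero_iff.2 hw)).trans
    (inverse_one_sub_smul_mul_inverse (isUnit_one_add_smul (hC.norm_plus_le_one hw) hz₀) w)

lemma CorrespondsTo.exists_analytic_continuation (hC : CorrespondsTo hV hz₀ C R)
    (hR : IsGeneralizedResolvent V R) (hΔ : ∃ U, IsOpen U ∧ U ∩ Metric.sphere 0 1 = Δ)
    {C' : ℂ → N V (z₀ : OnePoint ℂ) →L[ℂ] N V (invConj z₀)} (hC' : EqOn C' C {z : ℂ | ‖z‖ < 1})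
    (hcont : ContinuousOn C' ({z : ℂ | ‖z‖ < 1} ∪ Δ))
    (hunitary : ∀ lam ∈ Δ, plus hV hz₀ (C' lam) ∈ unitary (H →L[ℂ] H))
    (hunit : ∀ lam ∈ Δ, IsUnit (pencil z₀ lam (plus hV hz₀ (C' lam)))) :
    ∃ R' : ℂ → H →L[ℂ] H,
      AnalyticOnNhd ℂ R' ({z : ℂ | ‖z‖ < 1} ∪ {z : ℂ | 1 < ‖z‖} ∪ Δ) ∧
      EqOn R' R ({z : ℂ | ‖z‖ < 1} ∪ {z : ℂ | 1 < ‖z‖}) := by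
  have hΔ1 : ∀ lam ∈ Δ, ‖lam‖ = 1 := by
    obtain ⟨U, -, rfl⟩ := hΔ
    exact fun lam h => mem_sphere_zero_iff_norm.1 h.2
  refine exists_analyticOnNhd_of_add_star_eq_one
    (F := fun w => pencilResolvent z₀ w (plus hV hz₀ (C' w))) hΔ (fun z hz => hR.analyticAt hz)
    (fun z hz0 hz => hR.star_eq hz0 hz) ?_ (fun w hw => ?_) fun lam h => ?_
  · intro w hw
    refine tendsto_pencilResolvent nhdsWithin_le_nhds
      (((continuous_plus hV hz₀).tendsto _).comp (hcont w hw)) ?_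
    rcases hw with hw | hw
    · rw [hC' hw]
      exact isUnit_pencil hz₀ hw (hC.norm_plus_le_one hw)
    · exact hunit w hw
  · rw [hC.eq_pencilResolvent hw, ← hC' hw]
  · exact (pencilResolvent_add_star_eq_one_iff_mem_unitary hz₀ (hΔ1 lam h) (hunit lam h)).2
      (hunitary lam h)

lemma CorrespondsTo.exists_tendsto (hC : CorrespondsTo hV hz₀ C R)
    (hR : IsGeneralizedResolvent V R) {R' : ℂ → H →L[ℂ] H}
    (hR' : EqOn R' R ({z : ℂ | ‖z‖ < 1} ∪ {z : ℂ | 1 < ‖z‖})) {lam : ℂ} (hlam : ‖lam‖ = 1)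
    (hcont : ContinuousAt R' lam) :
    ∃ C₀, Tendsto C (𝓝[{z : ℂ | ‖z‖ < 1}] lam) (𝓝 C₀) ∧
      plus hV hz₀ C₀ ∈ unitary (H →L[ℂ] H) ∧ IsUnit (pencil z₀ lam (plus hV hz₀ C₀)) := by
  have := nhdsWithin_disc_neBot hlam
  have hlim : Tendsto (fun w => pencilResolvent z₀ w (plus hV hz₀ (C w)))
      (𝓝[{z : ℂ | ‖z‖ < 1}] lam) (𝓝 (R' lam)) :=
    hcont.continuousWithinAt.tendsto.congr' (eventually_nhdsWithin_of_forall fun w hw =>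
      (hR' (Or.inl hw)).trans (hC.eq_pencilResolvent hw))
  obtain ⟨T₀, hT₀, hunit, hRT⟩ := exists_tendsto_of_tendsto_pencilResolvent hz₀ hlam le_rfl
    (fun w hw => hC.norm_plus_le_one hw) hlim
  let compression (T : H →L[ℂ] H) : N V (z₀ : OnePoint ℂ) →L[ℂ] N V (invConj z₀) :=
    (N V (invConj z₀)).orthogonalProjectionOnto ∘L T ∘L (N V (z₀ : OnePoint ℂ)).subtypeL
  have hcompression : Continuous compression := by fun_prop
  have hC₀ : Tendsto C (𝓝[{z : ℂ | ‖z‖ < 1}] lam) (𝓝 (compression T₀)) :=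
    ((hcompression.tendsto T₀).comp hT₀).congr fun w => compression_plus hV hz₀ (C w)
  have hplus : plus hV hz₀ (compression T₀) = T₀ :=
    tendsto_nhds_unique (((continuous_plus hV hz₀).tendsto _).comp hC₀) hT₀
  refine ⟨compression T₀, hC₀, ?_, by rwa [hplus]⟩
  rw [hplus, ← pencilResolvent_add_star_eq_one_iff_mem_unitary hz₀ hlam hunit, hRT]
  exact add_star_eq_one_of_continuousAt (fun z hz0 hz => hR.star_eq hz0 hz) hR' hlam hcont

lemma CorrespondsTo.exists_continuous_extension (hC : CorrespondsTo hV hz₀ C R)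
    (hR : IsGeneralizedResolvent V R) (hΔ : ∀ lam ∈ Δ, ‖lam‖ = 1) {R' : ℂ → H →L[ℂ] H}
    (hR' : EqOn R' R ({z : ℂ | ‖z‖ < 1} ∪ {z : ℂ | 1 < ‖z‖}))
    (hcont : ∀ lam ∈ Δ, ContinuousAt R' lam) :
    ∃ C' : ℂ → N V (z₀ : OnePoint ℂ) →L[ℂ] N V (invConj z₀),
      EqOn C' C {z : ℂ | ‖z‖ < 1} ∧ ContinuousOn C' ({z : ℂ | ‖z‖ < 1} ∪ Δ) ∧
      ∀ lam ∈ Δ, plus hV hz₀ (C' lam) ∈ unitary (H →L[ℂ] H) ∧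
        IsUnit (pencil z₀ lam (plus hV hz₀ (C' lam))) := by
  have hCcont : ContinuousOn C {z : ℂ | ‖z‖ < 1} := by
    simpa only [ball_zero_eq] using hC.1.analytic.continuousOn
  have hboundary : ∀ lam ∈ Δ, ∃ C₀, Tendsto C (𝓝[{z : ℂ | ‖z‖ < 1}] lam) (𝓝 C₀) ∧
      plus hV hz₀ C₀ ∈ unitary (H →L[ℂ] H) ∧ IsUnit (pencil z₀ lam (plus hV hz₀ C₀)) :=
    fun lam h => hC.exists_tendsto hR hR' (hΔ lam h) (hcont lam h)
  refine ⟨extendFrom {z | ‖z‖ < 1} C, extendFrom_extends hCcont, continuousOn_extendFrom ?_ ?_,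
    fun lam h => ?_⟩
  · rw [← ball_zero_eq, closure_ball _ one_ne_zero]
    rintro w (hw | hw)
    · exact Metric.ball_subset_closedBall hw
    · exact mem_closedBall_zero_iff.2 (hΔ w hw).le
  · rintro w (hw | hw)
    · exact ⟨C w, hCcont w hw⟩
    · exact (hboundary w hw).imp fun _ => And.left
  · have := nhdsWithin_disc_neBot (hΔ lam h)
    obtain ⟨C₀, hC₀, hunitary, hunit⟩ := hboundary lam h
    rw [extendFrom_eq (mem_closure_iff_nhdsWithin_neBot.2 this) hC₀]
    exact ⟨hunitary, hunit⟩

end Continuation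

section Arc

lemma IsOpenArc.exists_isOpen_inter_sphere {Δ : Set ℂ} (hΔ : IsOpenArc Δ) :
    ∃ U, IsOpen U ∧ U ∩ Metric.sphere 0 1 = Δ := by
  obtain ⟨a, b, -, rfl⟩ := hΔ
  refine ⟨(fun s : ℂ => exp (s * I)) '' (re ⁻¹' Ioo a b), ?_, ?_⟩
  · exact isOpenMap_exp.comp (Homeomorph.mulRight₀ I I_ne_zero).isOpenMap _
      (isOpen_Ioo.preimage continuous_re)
  · ext z
    constructor
    · rintro ⟨⟨s, hs, rfl⟩, h⟩
      rw [mem_sphere_zero_iff_norm, norm_exp, mul_I_re, Real.exp_eq_one_iff, neg_eq_zero] at h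
      lift s to ℝ using h
      exact ⟨s, hs, rfl⟩
    · rintro ⟨t, ht, rfl⟩
      exact ⟨⟨t, ht, rfl⟩, mem_sphere_zero_iff_norm.2 (norm_exp_ofReal_mul_I t)⟩

lemma IsOpenArc.norm_eq_one {Δ : Set ℂ} (hΔ : IsOpenArc Δ) {lam : ℂ} (hlam : lam ∈ Δ) :
    ‖lam‖ = 1 := by
  obtain ⟨a, b, -, rfl⟩ := hΔ
  obtain ⟨t, -, rfl⟩ := hlam
  exact norm_exp_ofReal_mul_I t

lemma inverse_mobius_mobius {z lam : ℂ} (hz : ‖z‖ < 1) (hlam : ‖lam‖ ≤ 1) :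
    (z + (lam - z) / (1 - conj z * lam)) / (1 + (lam - z) / (1 - conj z * lam) * conj z) = lam := by
  have ha := one_sub_conj_mul_ne_zero hz hlam
  have hc := one_sub_mul_conj_ne_zero hz
  have hnum : z + (lam - z) / (1 - conj z * lam) =
      lam * (1 - z * conj z) / (1 - conj z * lam) := by
    rw [eq_div_iff ha]
    linear_combination div_mul_cancel₀ (lam - z) ha
  have hden : 1 + (lam - z) / (1 - conj z * lam) * conj z =
      (1 - z * conj z) / (1 - conj z * lam) := by
    rw [eq_div_iff ha]
    linear_combination conj z * div_mul_cancel₀ (lam - z) ha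
  rw [hnum, hden, div_div_div_cancel_right₀ ha, mul_div_cancel_right₀ _ hc]

end Arc

end IsometricGap

end

open IsometricGap in
theorem theorem5p4_general {H : Type*} [NormedAddCommGroup H] [InnerProductSpace ℂ H]
    [CompleteSpace H] {V : H →ₗ.[ℂ] H} (hV : IsClosedIsometric V) {Δ : Set ℂ}
    (hΔ : ∃ U, IsOpen U ∧ U ∩ Metric.sphere 0 1 = Δ) {z₀ : ℂ} (hz₀ : ‖z₀‖ < 1)
    (hrange : ∀ lam ∈ Δ, (M V (lam : OnePoint ℂ)).map (proj (M V (invConj z₀)) : H →ₗ[ℂ] H) =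
      M V (invConj z₀))
    {R : ℂ → H →L[ℂ] H} (hR : IsGeneralizedResolvent V R)
    {C : ℂ → N V (z₀ : OnePoint ℂ) →L[ℂ] N V (invConj z₀)} (hC : CorrespondsTo hV hz₀ C R) :
    (∃ R' : ℂ → H →L[ℂ] H,
        AnalyticOnNhd ℂ R' ({z : ℂ | ‖z‖ < 1} ∪ {z : ℂ | 1 < ‖z‖} ∪ Δ) ∧
        EqOn R' R ({z : ℂ | ‖z‖ < 1} ∪ {z : ℂ | 1 < ‖z‖})) ↔
      ∃ C' : ℂ → N V (z₀ : OnePoint ℂ) →L[ℂ] N V (invConj z₀),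
        EqOn C' C {z : ℂ | ‖z‖ < 1} ∧
        ContinuousOn C' ({z : ℂ | ‖z‖ < 1} ∪ Δ) ∧
        (∀ lam ∈ Δ, Isometry (C' lam) ∧ Function.Surjective (C' lam)) ∧
        (∀ lam ∈ Δ, Function.Injective (toPMap (C' lam) - W V z₀ lam).toFun ∧
          LinearMap.range (toPMap (C' lam) - W V z₀ lam).toFun = N V (invConj z₀)) := by
  have hΔ1 : ∀ lam ∈ Δ, ‖lam‖ = 1 := by
    obtain ⟨U, -, rfl⟩ := hΔ
    exact fun lam h => mem_sphere_zero_iff_norm.1 h.2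
  have hunitary T := plus_mem_unitary_iff hV hz₀ T
  have hunit T lam (h : lam ∈ Δ) := isUnit_pencil_plus_iff hV hz₀ T (hΔ1 lam h) (hrange lam h)
  constructor
  · rintro ⟨R', hR'an, hR'⟩
    obtain ⟨C', hC', hcont, hboundary⟩ := hC.exists_continuous_extension hR hΔ1 hR'
      fun lam h => (hR'an lam (Or.inr h)).continuousAt
    exact ⟨C', hC', hcont, fun lam h => (hunitary (C' lam)).1 (hboundary lam h).1,
      fun lam h => (hunit (C' lam) lam h).1 (hboundary lam h).2⟩
  · rintro ⟨C', hC', hcont, hiso, hbij⟩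
    exact hC.exists_analytic_continuation hR hΔ hC' hcont
      (fun lam h => (hunitary (C' lam)).2 (hiso lam h))
      fun lam h => (hunit (C' lam) lam h).2 (hbij lam h)

theorem theorem5p4 {H : Type*} [NormedAddCommGroup H] [InnerProductSpace ℂ H] [CompleteSpace H]
    (V : H →ₗ.[ℂ] H) (hV : IsometricGap.IsClosedIsometric V)
    (Δ : Set ℂ) (hΔ : IsometricGap.IsOpenArc Δ)
    (hreg : ∀ ζ ∈ Δ, IsometricGap.IsRegularType V ζ⁻¹)
    (z₀ : ℂ) (hz₀ : ‖z₀‖ < 1)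
    -- `ζ` runs over the arc `Δ₁`, so that `(z₀ + ζ) / (1 + ζ conj z₀)` runs over `Δ`
    (hrange : ∀ ζ ∈ (fun lam : ℂ => (lam - z₀) / (1 - conj z₀ * lam)) '' Δ,
      (IsometricGap.M V (((z₀ + ζ) / (1 + ζ * conj z₀) : ℂ) : OnePoint ℂ)).map
        (IsometricGap.proj (IsometricGap.M V (IsometricGap.invConj z₀)) : H →ₗ[ℂ] H) =
      IsometricGap.M V (IsometricGap.invConj z₀))
    (R : ℂ → H →L[ℂ] H) (hR : IsometricGap.IsGeneralizedResolvent V R)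
    (C : ℂ → IsometricGap.N V (z₀ : OnePoint ℂ) →L[ℂ]
      IsometricGap.N V (IsometricGap.invConj z₀))
    (hC : IsometricGap.CorrespondsTo hV hz₀ C R) :
    (∃ R' : ℂ → H →L[ℂ] H,
        AnalyticOnNhd ℂ R' ({z : ℂ | ‖z‖ < 1} ∪ {z : ℂ | 1 < ‖z‖} ∪ Δ) ∧
        EqOn R' R ({z : ℂ | ‖z‖ < 1} ∪ {z : ℂ | 1 < ‖z‖})) ↔
      ∃ C' : ℂ → IsometricGap.N V (z₀ : OnePoint ℂ) →L[ℂ]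
          IsometricGap.N V (IsometricGap.invConj z₀),
        EqOn C' C {z : ℂ | ‖z‖ < 1} ∧
        ContinuousOn C' ({z : ℂ | ‖z‖ < 1} ∪ Δ) ∧
        (∀ lam ∈ Δ, Isometry (C' lam) ∧ Function.Surjective (C' lam)) ∧
        (∀ lam ∈ Δ,
          Function.Injective (IsometricGap.toPMap (C' lam) - IsometricGap.W V z₀ lam).toFun ∧
          LinearMap.range (IsometricGap.toPMap (C' lam) - IsometricGap.W V z₀ lam).toFun =
            IsometricGap.N V (IsometricGap.invConj z₀)) :=
  theorem5p4_general hV hΔ.exists_isOpen_inter_sphere hz₀ (fun lam h => by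
    simpa only [IsometricGap.inverse_mobius_mobius hz₀ (hΔ.norm_eq_one h).le]
      using hrange _ ⟨lam, h, rfl⟩) hR hC
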